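/- Let $\mathbb{K}$ be a field, let $G$ be a finite simple graph with vertices $x_1,\dots,x_n$, and let $I(G)=(x_ix_j : \{x_i,x_j\}\in E(G))$ be its edge ideal in the standard graded polynomial ring $S=\mathbb{K}[x_1,\dots,x_n]$. For an ideal $I$ of $S$ and an integer $t\ge 1$ let $$I^{(t)}=\bigcap_{\mathfrak p\in\operatorname{Min}(I)}\operatorname{Ker}\bigl(S\to (S/I^t)_{\mathfrak p}\bigr)$$ be its $t$-th symbolic power, where $\operatorname{Min}(I)$ is the set of minimal primes of $I$. For a homogeneous ideal $I$ let $\operatorname{reg}(I)=\max\{j-i : \beta_{i,j}(I)\ne 0\}$ be its Castelnuovo--Mumford regularity, where $\beta_{i,j}(I)$ is the multiplicity of $S(-j)$ in the $i$-th module of the minimal graded free resolution of $I$ as an $S$-module (with $\operatorname{reg}(0)=-\infty$). Let $s\ge 1$ be an integer such that $G$ has no odd cycle of length at most $2s-3$. Then $$\operatorname{reg}\bigl(I(G)^{(s+1)}\bigr)\le \max\bigl\{\operatorname{reg}(I(G))+2s,\ \operatorname{reg}(I(G)^s)\bigr\}.$$ -/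

import Mathlib

open MvPolynomial

noncomputable section

/-- The edge ideal `I(G)` of a graph `G` in the polynomial ring `K[x_v : v ∈ V]`: it is generated
by the monomials `x_u x_v` with `u v` an edge of `G`. -/
def edgeIdeal (K : Type*) [Field K] {V : Type*} (G : SimpleGraph V) :
    Ideal (MvPolynomial V K) :=
  Ideal.span {f | ∃ u v : V, G.Adj u v ∧ f = X u * X v}

/-- The `s`-th symbolic power of an ideal `I` of `R`: the intersection, over the minimal primes `p`
of `I`, of the kernels of the natural maps `R → (R / I ^ s)_p`. -/
def Ideal.symbolicPower {R : Type*} [CommRing R] (I : Ideal R) (s : ℕ) : Ideal R :=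
  ⨅ p : I.minimalPrimes,
    haveI : p.1.IsPrime := Ideal.IsMinimalPrime.isPrime p.2
    LinearMap.ker
      ((LocalizedModule.mkLinearMap p.1.primeCompl (R ⧸ I ^ s)) ∘ₗ (I ^ s).mkQ)

/-- `v` is a homogeneous element of degree `j` of the graded free module `⨁ c, S(-deg c)`, where
`S = K[x_v : v ∈ V]` is standard graded: each nonzero coordinate `v c` is a form of degree
`j - deg c`. -/
def IsHomogeneousVector {K V : Type*} [Field K] {ι : Type*} (deg : ι → ℤ)
    (v : ι → MvPolynomial V K) (j : ℤ) : Prop :=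
  ∀ c : ι, ∀ m ∈ (v c).support, (m.degree : ℤ) + deg c = j

/-- A minimal graded free resolution
`⋯ → F 2 → F 1 → F 0 → I → 0` of an ideal `I` of the standard graded polynomial ring
`S = K[x_v : v ∈ V]`, with `F i = ⨁ b : Fin (rank i), S(-deg i b)` of finite rank. -/
structure MinimalGradedFreeResolution {K V : Type*} [Field K] (I : Ideal (MvPolynomial V K)) where
  /-- the rank of `F i` -/
  rank : ℕ → ℕ
  /-- the degrees of the basis elements of `F i` -/
  deg : ∀ i, Fin (rank i) → ℤ
  /-- the augmentation `F 0 → I ⊆ S` -/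
  aug : (Fin (rank 0) → MvPolynomial V K) →ₗ[MvPolynomial V K] MvPolynomial V K
  /-- the differential `F (i + 1) → F i` -/
  d : ∀ i, (Fin (rank (i + 1)) → MvPolynomial V K) →ₗ[MvPolynomial V K]
    (Fin (rank i) → MvPolynomial V K)
  /-- the augmentation preserves degrees -/
  aug_homogeneous : ∀ b, ∀ m ∈ (aug (Pi.single b 1)).support, (m.degree : ℤ) = deg 0 b
  /-- the differentials preserve degrees -/
  d_homogeneous : ∀ i b, IsHomogeneousVector (deg i) (d i (Pi.single b 1)) (deg (i + 1) b)
  /-- the augmentation maps onto `I` -/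
  range_aug : LinearMap.range aug = I
  /-- exactness at `F 0` -/
  exact_zero : LinearMap.ker aug = LinearMap.range (d 0)
  /-- exactness at `F (i + 1)` -/
  exact_succ : ∀ i, LinearMap.ker (d i) = LinearMap.range (d (i + 1))
  /-- minimality: the entries of the matrices of the differentials lie in the ideal generated by
  the variables -/
  minimal : ∀ i b c, constantCoeff (d i (Pi.single b 1) c) = 0

open Classical in
/-- The graded Betti number `β_{i,j}(I)`: the multiplicity of `S(-j)` in the `i`-th module of a
minimal graded free resolution of `I` (which is unique up to isomorphism, and exists whenever `V` is
finite and `I` is homogeneous). -/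
def gradedBetti {K V : Type*} [Field K] (I : Ideal (MvPolynomial V K)) (i : ℕ) (j : ℤ) : ℕ :=
  if h : Nonempty (MinimalGradedFreeResolution I) then
    Nat.card {b : Fin (h.some.rank i) // h.some.deg i b = j}
  else 0

/-- The Castelnuovo-Mumford regularity `reg(I) = max {j - i | β_{i,j}(I) ≠ 0}` of an ideal,
regarded as a graded module; the regularity of the zero ideal is `⊥`, that is, `-∞`. -/
def regularity {K V : Type*} [Field K] (I : Ideal (MvPolynomial V K)) : WithBot (WithTop ℤ) :=
  sSup {r | ∃ (i : ℕ) (j : ℤ), gradedBetti I i j ≠ 0 ∧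
    r = (((j - i : ℤ) : WithTop ℤ) : WithBot (WithTop ℤ))}

end

/-!
For a set of monomials closed under multiplication by variables, the graded Betti numbers are the
dimensions of the reduced homology of the upper Koszul complexes, so that a bound on the regularity
is a vanishing statement about simplicial complexes.

Order the products `m₁ > m₂ > ⋯` of `s` edges lexicographically and adjoin them one by one to the
symbolic power `J` of exponent `s + 1`. By Mayer–Vietoris, `reg J` is at most the maximum of
`reg (J + I(G)^s)` and the numbers `reg ((J + (m₁, …, mₖ₋₁)) : mₖ) + 2s`. By an exchange property
of the lexicographic order, the `k`-th colon ideal is `J : mₖ` plus an ideal generated by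
variables. The ideal `J : mₖ` arises from `I(G)` by `s` steps of the form
`Q ↦ (Q : x_u) ∩ (Q : x_v)`, one for each edge factor `x_u x_v` of `mₖ`, among quadratic monomial
ideals; such a step does not increase the regularity. Hence every colon ideal has regularity at
most `reg I(G)`.

If `G` has no short odd cycle, then `J ⊆ I(G)^s`. For a monomial of `J`, replace each vertex by as
many copies as its exponent says. The vertex covers of the resulting graph have at least `s + 1`
elements, and a matching with `s` edges is found either by König's theorem or from a shortest odd
cycle.
-/

open Finsupp (single)

noncomputable section

section KoszulDifferential

variable {V : Type*} [LinearOrder V]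

/-- The sign `±1` with which the vertex `x` occurs in the oriented boundary of the face
`insert x τ`. -/
def koszulSign (x : V) (τ : Finset V) : ℤ := (-1) ^ (τ.filter (· < x)).card

lemma koszulSign_mul_self (x : V) (τ : Finset V) : koszulSign x τ * koszulSign x τ = 1 := by
  rw [koszulSign, ← mul_pow, neg_one_mul, neg_neg, one_pow]

lemma koszulSign_insert {x : V} {τ : Finset V} (y : V) (hx : x ∉ τ) :
    koszulSign y (insert x τ) = (if x < y then -1 else 1) * koszulSign y τ := by
  rw [koszulSign, Finset.filter_insert]
  split_ifs
  · rw [Finset.card_insert_of_notMem (by simp [hx]), pow_succ', koszulSign]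
  · rw [one_mul, koszulSign]

lemma koszulSign_insert_self {x : V} {τ : Finset V} (hx : x ∉ τ) :
    koszulSign x (insert x τ) = koszulSign x τ := by
  rw [koszulSign_insert x hx, if_neg (lt_irrefl x), one_mul]

lemma koszulSign_mul_insert {x y : V} {τ : Finset V} (hx : x ∉ τ) (hy : y ∉ τ) (hxy : x ≠ y) :
    koszulSign x τ * koszulSign y (insert x τ) =
      -(koszulSign y τ * koszulSign x (insert y τ)) := by
  rw [koszulSign_insert y hx, koszulSign_insert x hy]
  rcases lt_or_gt_of_ne hxy with h | h <;> rw [if_pos h, if_neg h.not_gt] <;> ring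

lemma koszulSign_insert_mul_insert {x y : V} {τ : Finset V} (hx : x ∉ τ) (hy : y ∉ τ)
    (hxy : x ≠ y) :
    koszulSign x (insert y τ) * koszulSign y (insert x τ) =
      -(koszulSign x τ * koszulSign y τ) := by
  rw [koszulSign_insert y hx, koszulSign_insert x hy]
  rcases lt_or_gt_of_ne hxy with h | h <;> rw [if_pos h, if_neg h.not_gt] <;> ring

variable {R N : Type*} [CommRing R] [AddCommGroup N] [Module R N]

/-- Exterior multiplication by the basis vector `e_v` on `N ⊗ ⋀ R^V`, a chain being given by its
coefficients at the finite subsets of `V`. It is a contracting homotopy of the Koszul differential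
wherever the `v`-th member of the sequence is invertible. -/
def koszulHomotopy (v : V) (c : Finset V → N) (τ : Finset V) : N :=
  if v ∈ τ then koszulSign v τ • c (τ.erase v) else 0

lemma koszulHomotopy_insert {v : V} {τ : Finset V} (hv : v ∉ τ) (c : Finset V → N) :
    koszulHomotopy v c (insert v τ) = koszulSign v τ • c τ := by
  rw [koszulHomotopy, if_pos (Finset.mem_insert_self v τ), Finset.erase_insert hv,
    koszulSign_insert_self hv]

lemma koszulHomotopy_of_notMem {v : V} {τ : Finset V} (hv : v ∉ τ) (c : Finset V → N) :
    koszulHomotopy v c τ = 0 := if_neg hv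

lemma koszulHomotopy_zero (v : V) : koszulHomotopy v (0 : Finset V → N) = 0 := by
  ext τ
  simp [koszulHomotopy]

variable [Fintype V]

/-- The Koszul differential on `N ⊗ ⋀ R^V` with respect to the sequence `w`, a chain being given by
its coefficients at the finite subsets of `V`. -/
def koszulDifferential (w : V → R) : (Finset V → N) →ₗ[R] (Finset V → N) where
  toFun c τ := ∑ x ∈ τᶜ, koszulSign x τ • w x • c (insert x τ)
  map_add' c c' := by
    ext τ
    simp [Finset.sum_add_distrib, smul_add]
  map_smul' r c := by
    ext τ
    simp only [Pi.smul_apply, RingHom.id_apply, Finset.smul_sum]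
    refine Finset.sum_congr rfl fun x _ => ?_
    rw [smul_comm (w x) r, smul_comm (koszulSign x τ) r]

lemma koszulDifferential_apply (w : V → R) (c : Finset V → N) (τ : Finset V) :
    koszulDifferential w c τ = ∑ x ∈ τᶜ, koszulSign x τ • w x • c (insert x τ) := rfl

lemma koszulDifferential_comp_self (w : V → R) (c : Finset V → N) :
    koszulDifferential w (koszulDifferential w c) = 0 := by
  ext τ
  simp only [koszulDifferential_apply, Pi.zero_apply, Finset.smul_sum]
  rw [Finset.sum_sigma']
  have mem_iff (x y : V) : (⟨x, y⟩ : Σ _ : V, V) ∈ τᶜ.sigma (fun x => (insert x τ)ᶜ) ↔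
      x ∉ τ ∧ y ≠ x ∧ y ∉ τ := by simp
  refine Finset.sum_involution (fun p _ => ⟨p.2, p.1⟩) ?_ ?_ ?_ fun _ _ => rfl
  · rintro ⟨x, y⟩ h
    obtain ⟨hx, hyx, hy⟩ := (mem_iff x y).1 h
    rw [Finset.insert_comm y x τ]
    simp only [smul_comm (w _) (koszulSign _ _), smul_smul,
      koszulSign_mul_insert hx hy hyx.symm]
    rw [mul_comm (w y) (w x), neg_smul, neg_add_cancel]
  · rintro ⟨x, y⟩ h _ h'
    exact ((mem_iff x y).1 h).2.1 (congrArg Sigma.fst h')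
  · rintro ⟨x, y⟩ h
    obtain ⟨hx, hyx, hy⟩ := (mem_iff x y).1 h
    exact (mem_iff y x).2 ⟨hy, hyx.symm, hx⟩

lemma koszulDifferential_koszulHomotopy (w : V → R) (v : V) (c : Finset V → N) :
    koszulDifferential w (koszulHomotopy v c) + koszulHomotopy v (koszulDifferential w c) =
      w v • c := by
  ext τ
  rw [Pi.add_apply, Pi.smul_apply]
  by_cases hv : v ∈ τ
  · obtain ⟨σ, hσ, rfl⟩ : ∃ σ, v ∉ σ ∧ τ = insert v σ :=
      ⟨τ.erase v, Finset.notMem_erase v τ, (Finset.insert_erase hv).symm⟩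
    have hcompl : σᶜ = insert v (insert v σ)ᶜ := by
      ext y
      by_cases h : y = v <;> simp [h, hσ]
    rw [koszulHomotopy_insert hσ, koszulDifferential_apply, koszulDifferential_apply, hcompl,
      Finset.sum_insert (by simp), smul_add, smul_smul, koszulSign_mul_self, one_smul,
      add_left_comm, Finset.smul_sum, ← Finset.sum_add_distrib, Finset.sum_eq_zero, add_zero]
    intro x hx
    simp only [Finset.mem_compl, Finset.mem_insert, not_or] at hx
    rw [Finset.insert_comm, koszulHomotopy_insert (by simp [hσ, Ne.symm hx.1]),
      smul_comm (w x), smul_smul, smul_smul, ← add_smul,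
      koszulSign_insert_mul_insert hx.2 hσ hx.1, mul_comm (koszulSign v σ), neg_add_cancel,
      zero_smul]
  · rw [koszulHomotopy_of_notMem hv, add_zero, koszulDifferential_apply,
      Finset.sum_eq_single_of_mem v (by simpa using hv)]
    · rw [koszulHomotopy_insert hv, smul_comm (w v), smul_smul, koszulSign_mul_self, one_smul]
    · intro x _ hxv
      rw [koszulHomotopy_of_notMem (by simp [hv, hxv.symm]), smul_zero, smul_zero]

end KoszulDifferential

section LinksAndDeletions

variable {V : Type*} {Δ : Set (Finset V)} {x : V}

/-- The faces of `Δ` that do not contain the vertex `x`. -/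
def deletion (Δ : Set (Finset V)) (x : V) : Set (Finset V) := {τ ∈ Δ | x ∉ τ}

lemma isLowerSet_deletion (hΔ : IsLowerSet Δ) : IsLowerSet (deletion Δ x) :=
  fun _ _ h hτ => ⟨hΔ h hτ.1, fun hx => hτ.2 (h hx)⟩

variable [DecidableEq V]

/-- The sets of vertices that span a face of `Δ` together with the vertex `x`. -/
def closedStar (Δ : Set (Finset V)) (x : V) : Set (Finset V) := {τ | insert x τ ∈ Δ}

/-- The faces of the closed star of `x` that do not contain `x`. -/
def link (Δ : Set (Finset V)) (x : V) : Set (Finset V) := {τ | x ∉ τ ∧ insert x τ ∈ Δ}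

lemma isLowerSet_closedStar (hΔ : IsLowerSet Δ) : IsLowerSet (closedStar Δ x) :=
  fun _ _ h hτ => hΔ (Finset.insert_subset_insert x h) hτ

lemma deletion_inter_closedStar (hΔ : IsLowerSet Δ) :
    deletion Δ x ∩ closedStar Δ x = link Δ x :=
  Set.ext fun τ => ⟨fun h => ⟨h.1.2, h.2⟩,
    fun h => ⟨⟨hΔ (Finset.subset_insert x τ) h.2, h.1⟩, h.2⟩⟩

lemma deletion_union_closedStar (hΔ : IsLowerSet Δ) : deletion Δ x ∪ closedStar Δ x = Δ := by
  ext τ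
  refine ⟨fun h => h.elim And.left fun h => hΔ (Finset.subset_insert x τ) h, fun h => ?_⟩
  by_cases hx : x ∈ τ
  · exact Or.inr (by rwa [closedStar, Set.mem_ofPred_eq, Finset.insert_eq_self.2 hx])
  · exact Or.inl ⟨h, hx⟩

end LinksAndDeletions

section Acyclicity

variable {V : Type*} {R : Type*} [CommRing R]

variable (R) in
/-- The simplicial chains with coefficients in `R` on the faces of `Δ` with `p` vertices, that is,
of dimension `p - 1`. -/
def simplicialChains (Δ : Set (Finset V)) (p : ℕ) : Submodule R (Finset V → R) :=
  Submodule.pi {τ | τ ∈ Δ ∧ τ.card = p}ᶜ fun _ => ⊥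

variable {A B Δ : Set (Finset V)} {p : ℕ} {c : Finset V → R}

lemma mem_simplicialChains :
    c ∈ simplicialChains R Δ p ↔ ∀ τ, c τ ≠ 0 → τ ∈ Δ ∧ τ.card = p := by
  simp only [simplicialChains, Submodule.mem_pi, Set.mem_compl_iff, Set.mem_ofPred_eq,
    Submodule.mem_bot]
  exact forall_congr' fun _ => not_imp_comm

lemma simplicialChains_mono (hAB : A ⊆ B) : simplicialChains R A p ≤ simplicialChains R B p :=
  fun _ hc => mem_simplicialChains.2 fun τ hτ =>
    (mem_simplicialChains.1 hc τ hτ).imp_left (@hAB τ)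

lemma simplicialChains_inter :
    simplicialChains R (A ∩ B) p = simplicialChains R A p ⊓ simplicialChains R B p :=
  le_antisymm
    (le_inf (simplicialChains_mono Set.inter_subset_left)
      (simplicialChains_mono Set.inter_subset_right))
    fun _ hc => mem_simplicialChains.2 fun τ hτ =>
      have hA := mem_simplicialChains.1 hc.1 τ hτ
      ⟨⟨hA.1, (mem_simplicialChains.1 hc.2 τ hτ).1⟩, hA.2⟩

lemma simplicialChains_union :
    simplicialChains R (A ∪ B) p = simplicialChains R A p ⊔ simplicialChains R B p := by
  classical
  refine le_antisymm (fun c hc => ?_)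
    (sup_le (simplicialChains_mono Set.subset_union_left)
      (simplicialChains_mono Set.subset_union_right))
  rw [mem_simplicialChains] at hc
  refine Submodule.mem_sup.2 ⟨fun τ => if τ ∈ A then c τ else 0,
    mem_simplicialChains.2 fun τ hτ => ?_, fun τ => if τ ∈ A then 0 else c τ,
    mem_simplicialChains.2 fun τ hτ => ?_, ?_⟩
  · obtain ⟨hA, hne⟩ := ite_ne_right_iff.1 hτ
    exact ⟨hA, (hc τ hne).2⟩
  · obtain ⟨hA, hne⟩ := ite_ne_left_iff.1 hτ
    exact ⟨(hc τ hne.symm).1.resolve_left hA, (hc τ hne.symm).2⟩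
  · ext τ
    by_cases hA : τ ∈ A <;> simp [hA]

variable [LinearOrder V] [Fintype V]

/-- The oriented simplicial boundary map of the full simplex on `V`. -/
abbrev simplicialBoundary : (Finset V → R) →ₗ[R] (Finset V → R) :=
  koszulDifferential fun _ => (1 : R)

lemma simplicialBoundary_mem_simplicialChains (hΔ : IsLowerSet Δ)
    (hc : c ∈ simplicialChains R Δ (p + 1)) : simplicialBoundary c ∈ simplicialChains R Δ p := by
  rw [mem_simplicialChains] at hc ⊢
  intro τ hτ
  obtain ⟨x, hx, hne⟩ := Finset.exists_ne_zero_of_sum_ne_zero hτ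
  obtain ⟨hmem, hcard⟩ := hc _ (right_ne_zero_of_smul (right_ne_zero_of_smul hne))
  rw [Finset.card_insert_of_notMem (Finset.mem_compl.1 hx)] at hcard
  exact ⟨hΔ (Finset.subset_insert x τ) hmem, Nat.succ_injective hcard⟩

lemma simplicialBoundary_eq_zero (hc : c ∈ simplicialChains R Δ 0) : simplicialBoundary c = 0 := by
  ext τ
  refine Finset.sum_eq_zero fun x _ => ?_
  have hx : c (insert x τ) = 0 := by
    by_contra hne
    exact Finset.insert_ne_empty x τ (Finset.card_eq_zero.1 (mem_simplicialChains.1 hc _ hne).2)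
  rw [hx, smul_zero, smul_zero]

variable (R) in
/-- The reduced homology of `Δ` with coefficients in `R` vanishes in dimension `p - 1`. -/
def AcyclicAt (Δ : Set (Finset V)) (p : ℕ) : Prop :=
  ∀ c ∈ simplicialChains R Δ p, simplicialBoundary c = 0 →
    ∃ c' ∈ simplicialChains R Δ (p + 1), simplicialBoundary c' = c

lemma acyclicAt_empty : AcyclicAt R (∅ : Set (Finset V)) p := by
  intro c hc _
  refine ⟨0, zero_mem _, ?_⟩
  ext τ
  by_contra hτ
  exact (mem_simplicialChains.1 hc τ fun h => hτ (by rw [map_zero, h, Pi.zero_apply])).1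

lemma AcyclicAt.exists_singleton_mem [Nontrivial R] (h : AcyclicAt R Δ 0) (hΔ : ∅ ∈ Δ) :
    ∃ x, {x} ∈ Δ := by
  have hmem : Pi.single ∅ 1 ∈ simplicialChains R Δ 0 := by
    refine mem_simplicialChains.2 fun τ hτ => ?_
    obtain rfl : τ = ∅ := by
      by_contra hne
      exact hτ (Pi.single_eq_of_ne hne 1)
    exact ⟨hΔ, Finset.card_empty⟩
  obtain ⟨c, hc, hbd⟩ := h _ hmem (simplicialBoundary_eq_zero hmem)
  have hsum : simplicialBoundary c ∅ ≠ 0 := by simp [hbd]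
  obtain ⟨x, -, hx⟩ := Finset.exists_ne_zero_of_sum_ne_zero hsum
  have hface := mem_simplicialChains.1 hc _ (right_ne_zero_of_smul (right_ne_zero_of_smul hx))
  exact ⟨x, by simpa using hface.1⟩

lemma acyclicAt_of_cone (v : V) (h : ∀ τ ∈ Δ, insert v τ ∈ Δ) : AcyclicAt R Δ p := by
  intro c hc hbd
  refine ⟨koszulHomotopy v c, mem_simplicialChains.2 fun τ hτ => ?_, ?_⟩
  · obtain ⟨hv, hne⟩ := ite_ne_right_iff.1 hτ
    obtain ⟨hmem, hcard⟩ := mem_simplicialChains.1 hc _ (right_ne_zero_of_smul hne)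
    refine ⟨Finset.insert_erase hv ▸ h _ hmem, ?_⟩
    rw [← hcard, Finset.card_erase_add_one hv]
  · have := koszulDifferential_koszulHomotopy (fun _ : V => (1 : R)) v c
    rwa [hbd, koszulHomotopy_zero, add_zero, one_smul] at this

/-! ### The Mayer–Vietoris sequence -/

lemma AcyclicAt.of_inter_of_union (hA : IsLowerSet A) (hB : IsLowerSet B)
    (hinter : AcyclicAt R (A ∩ B) p) (hunion : AcyclicAt R (A ∪ B) p) : AcyclicAt R A p := by
  intro c hc hbd
  obtain ⟨γ, hγ, rfl⟩ := hunion c (simplicialChains_mono Set.subset_union_left hc) hbd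
  rw [simplicialChains_union] at hγ
  obtain ⟨a, ha, b, hb, rfl⟩ := Submodule.mem_sup.1 hγ
  have hb' : simplicialBoundary b ∈ simplicialChains R (A ∩ B) p := by
    rw [simplicialChains_inter]
    refine ⟨?_, simplicialBoundary_mem_simplicialChains hB hb⟩
    rw [map_add] at hc
    exact (Submodule.add_mem_iff_right _ (simplicialBoundary_mem_simplicialChains hA ha)).1 hc
  obtain ⟨ν, hν, hν'⟩ := hinter _ hb' (koszulDifferential_comp_self _ _)
  exact ⟨a + ν, add_mem ha (simplicialChains_mono Set.inter_subset_left hν),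
    by rw [map_add, map_add, hν']⟩

lemma AcyclicAt.inter (hA : IsLowerSet A) (hB : IsLowerSet B) (hAp : AcyclicAt R A p)
    (hBp : AcyclicAt R B p) (hunion : AcyclicAt R (A ∪ B) (p + 1)) : AcyclicAt R (A ∩ B) p := by
  intro c hc hbd
  rw [simplicialChains_inter] at hc
  obtain ⟨α, hα, hαc⟩ := hAp c hc.1 hbd
  obtain ⟨β, hβ, hβc⟩ := hBp c hc.2 hbd
  obtain ⟨γ, hγ, hγ'⟩ := hunion (α - β)
    (sub_mem (simplicialChains_mono Set.subset_union_left hα)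
      (simplicialChains_mono Set.subset_union_right hβ))
    (by rw [map_sub, hαc, hβc, sub_self])
  rw [simplicialChains_union] at hγ
  obtain ⟨a, ha, b, hb, rfl⟩ := Submodule.mem_sup.1 hγ
  have heq : α - simplicialBoundary a = β + simplicialBoundary b := by
    rw [sub_eq_iff_eq_add, add_assoc, add_comm (simplicialBoundary b), ← map_add, hγ',
      add_sub_cancel]
  refine ⟨α - simplicialBoundary a, ?_, ?_⟩
  · rw [simplicialChains_inter]
    exact ⟨sub_mem hα (simplicialBoundary_mem_simplicialChains hA ha),
      heq ▸ add_mem hβ (simplicialBoundary_mem_simplicialChains hB hb)⟩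
  · rw [map_sub, hαc, koszulDifferential_comp_self, sub_zero]

lemma AcyclicAt.union_zero (hA : AcyclicAt R A 0) (hB : AcyclicAt R B 0) :
    AcyclicAt R (A ∪ B) 0 := by
  intro c hc _
  rw [simplicialChains_union] at hc
  obtain ⟨a, ha, b, hb, rfl⟩ := Submodule.mem_sup.1 hc
  obtain ⟨α, hα, rfl⟩ := hA a ha (simplicialBoundary_eq_zero ha)
  obtain ⟨β, hβ, rfl⟩ := hB b hb (simplicialBoundary_eq_zero hb)
  exact ⟨α + β, add_mem (simplicialChains_mono Set.subset_union_left hα)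
    (simplicialChains_mono Set.subset_union_right hβ), map_add _ _ _⟩

lemma AcyclicAt.union_succ (hA : IsLowerSet A) (hB : IsLowerSet B) (hAp : AcyclicAt R A (p + 1))
    (hBp : AcyclicAt R B (p + 1)) (hinter : AcyclicAt R (A ∩ B) p) :
    AcyclicAt R (A ∪ B) (p + 1) := by
  intro c hc hbd
  rw [simplicialChains_union] at hc
  obtain ⟨a, ha, b, hb, rfl⟩ := Submodule.mem_sup.1 hc
  have hab : simplicialBoundary a = -simplicialBoundary b := by
    rw [map_add] at hbd
    exact eq_neg_of_add_eq_zero_left hbd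
  have ha' : simplicialBoundary a ∈ simplicialChains R (A ∩ B) p := by
    rw [simplicialChains_inter]
    exact ⟨simplicialBoundary_mem_simplicialChains hA ha,
      hab ▸ neg_mem (simplicialBoundary_mem_simplicialChains hB hb)⟩
  obtain ⟨ν, hν, hνa⟩ := hinter _ ha' (koszulDifferential_comp_self _ _)
  obtain ⟨α, hα, hαa⟩ := hAp (a - ν) (sub_mem ha (simplicialChains_mono Set.inter_subset_left hν))
    (by rw [map_sub, hνa, sub_self])
  obtain ⟨β, hβ, hβb⟩ := hBp (b + ν) (add_mem hb (simplicialChains_mono Set.inter_subset_right hν))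
    (by rw [map_add, hνa, hab, add_neg_cancel])
  exact ⟨α + β, add_mem (simplicialChains_mono Set.subset_union_left hα)
    (simplicialChains_mono Set.subset_union_right hβ), by rw [map_add, hαa, hβb]; abel⟩

/-! ### The exact sequence of a vertex -/

variable {x : V}

lemma acyclicAt_closedStar : AcyclicAt R (closedStar Δ x) p :=
  acyclicAt_of_cone x fun τ hτ => by
    rwa [closedStar, Set.mem_ofPred_eq, Finset.insert_idem]

lemma acyclicAt_deletion (hΔ : IsLowerSet Δ) (h : AcyclicAt R Δ p)
    (hlink : AcyclicAt R (link Δ x) p) : AcyclicAt R (deletion Δ x) p :=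
  .of_inter_of_union (isLowerSet_deletion hΔ) (isLowerSet_closedStar hΔ)
    (by rwa [deletion_inter_closedStar hΔ]) (by rwa [deletion_union_closedStar hΔ])

lemma acyclicAt_link (hΔ : IsLowerSet Δ) (h : AcyclicAt R Δ (p + 1))
    (hdel : AcyclicAt R (deletion Δ x) p) : AcyclicAt R (link Δ x) p := by
  rw [← deletion_inter_closedStar hΔ]
  exact hdel.inter (isLowerSet_deletion hΔ) (isLowerSet_closedStar hΔ) acyclicAt_closedStar
    (by rwa [deletion_union_closedStar hΔ])

lemma acyclicAt_of_deletion_of_link (hΔ : IsLowerSet Δ)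
    (hdel : AcyclicAt R (deletion Δ x) p)
    (hlink : ∀ q, p = q + 1 → AcyclicAt R (link Δ x) q) : AcyclicAt R Δ p := by
  rw [← deletion_union_closedStar hΔ (x := x)]
  cases p with
  | zero => exact hdel.union_zero acyclicAt_closedStar
  | succ p =>
    refine hdel.union_succ (isLowerSet_deletion hΔ) (isLowerSet_closedStar hΔ)
      acyclicAt_closedStar ?_
    rw [deletion_inter_closedStar hΔ]
    exact hlink p rfl

end Acyclicity

section MonomialKoszulComplexes

/-! ### Upper Koszul complexes of sets of monomials -/

variable {V : Type*} {U U' : Set (V →₀ ℕ)} {W : Set V} {a b : V →₀ ℕ} {x : V} {τ σ : Finset V}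

lemma exists_eq_add_single (hx : b x ≠ 0) : ∃ b', b = b' + single x 1 :=
  ⟨b - single x 1, (tsub_add_cancel_of_le
    (Finsupp.single_le_iff.2 (Nat.one_le_iff_ne_zero.2 hx))).symm⟩

/-- The exponent of the squarefree monomial `∏ x ∈ τ, X x`. -/
def indicatorVec (τ : Finset V) : V →₀ ℕ := ∑ x ∈ τ, single x 1

lemma indicatorVec_apply [DecidableEq V] (τ : Finset V) (x : V) :
    indicatorVec τ x = if x ∈ τ then 1 else 0 := by
  simp [indicatorVec, Finsupp.single_apply]

lemma indicatorVec_insert [DecidableEq V] (hx : x ∉ τ) :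
    indicatorVec (insert x τ) = indicatorVec τ + single x 1 := by
  rw [indicatorVec, Finset.sum_insert hx, add_comm, indicatorVec]

lemma degree_indicatorVec (τ : Finset V) : (indicatorVec τ).degree = τ.card := by
  simp [indicatorVec, Finsupp.degree_single]

/-- The colon `(U : X ^ m)` of a set `U` of exponents of monomials. -/
def monomialColon (U : Set (V →₀ ℕ)) (m : V →₀ ℕ) : Set (V →₀ ℕ) := {b | b + m ∈ U}

/-- The exponents of the monomials divisible by a variable in `W`. -/
def variableMonomials (W : Set V) : Set (V →₀ ℕ) := {b | ∃ w ∈ W, b w ≠ 0}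

/-- The upper Koszul complex of a set `U` of monomials in the multidegree `a`. -/
def koszulComplex (U : Set (V →₀ ℕ)) (a : V →₀ ℕ) : Set (Finset V) :=
  {τ | ∃ b ∈ U, b + indicatorVec τ = a}

lemma isUpperSet_monomialColon (hU : IsUpperSet U) (m : V →₀ ℕ) :
    IsUpperSet (monomialColon U m) :=
  fun _ _ h hb => hU (add_le_add_left h m) hb

lemma isUpperSet_variableMonomials (W : Set V) : IsUpperSet (variableMonomials W) :=
  fun _ _ h ⟨w, hw, hb⟩ => ⟨w, hw, (Nat.pos_of_ne_zero hb |>.trans_le (h w)).ne'⟩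

lemma isLowerSet_koszulComplex (hU : IsUpperSet U) (a : V →₀ ℕ) :
    IsLowerSet (koszulComplex U a) := by
  classical
  rintro τ σ hσ ⟨b, hb, rfl⟩
  refine ⟨b + indicatorVec (τ \ σ), hU le_self_add hb, ?_⟩
  rw [add_assoc, indicatorVec, indicatorVec, Finset.sum_sdiff hσ, indicatorVec]

lemma koszulComplex_union :
    koszulComplex (U ∪ U') a = koszulComplex U a ∪ koszulComplex U' a := by
  ext τ
  exact ⟨fun ⟨b, hb, h⟩ => hb.imp (⟨b, ·, h⟩) (⟨b, ·, h⟩),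
    fun h => h.elim (fun ⟨b, hb, h⟩ => ⟨b, .inl hb, h⟩) fun ⟨b, hb, h⟩ => ⟨b, .inr hb, h⟩⟩

lemma koszulComplex_inter :
    koszulComplex (U ∩ U') a = koszulComplex U a ∩ koszulComplex U' a := by
  ext τ
  refine ⟨fun ⟨b, hb, h⟩ => ⟨⟨b, hb.1, h⟩, ⟨b, hb.2, h⟩⟩, ?_⟩
  rintro ⟨⟨b, hb, rfl⟩, b', hb', h⟩
  exact ⟨b, ⟨hb, add_right_cancel h ▸ hb'⟩, rfl⟩

lemma koszulComplex_union_variableMonomials (hW : ∀ w ∈ W, a w = 0) :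
    koszulComplex (U ∪ variableMonomials W) a = koszulComplex U a := by
  rw [koszulComplex_union, Set.union_eq_left]
  rintro τ ⟨b, ⟨w, hw, hb⟩, rfl⟩
  exact absurd (Nat.eq_zero_of_add_eq_zero_right (hW w hw)) hb

lemma koszulComplex_inter_Ici (U : Set (V →₀ ℕ)) (m a : V →₀ ℕ) :
    koszulComplex (U ∩ Set.Ici m) (a + m) = koszulComplex (monomialColon U m) a := by
  ext τ
  constructor
  · rintro ⟨b, ⟨hb, hmb⟩, h⟩
    obtain ⟨b', rfl⟩ := exists_add_of_le (Set.mem_Ici.1 hmb)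
    rw [add_comm m] at hb h
    rw [add_right_comm] at h
    exact ⟨b', hb, add_right_cancel h⟩
  · rintro ⟨b, hb, rfl⟩
    exact ⟨b + m, ⟨hb, Set.mem_Ici.2 le_add_self⟩, add_right_comm _ _ _⟩

lemma koszulComplex_inter_Ici_of_not_le {m : V →₀ ℕ} (hm : ¬ m ≤ a) :
    koszulComplex (U ∩ Set.Ici m) a = ∅ := by
  refine Set.eq_empty_of_forall_notMem ?_
  rintro τ ⟨b, ⟨_, hb⟩, rfl⟩
  exact hm (le_trans hb le_self_add)

lemma koszulComplex_monomialColon_single_of_ne_zero (hx : a x ≠ 0) :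
    koszulComplex (monomialColon U (single x 1)) a = koszulComplex U (a + single x 1) := by
  classical
  ext τ
  constructor
  · rintro ⟨b, hb, rfl⟩
    exact ⟨_, hb, add_right_comm _ _ _⟩
  · rintro ⟨b, hb, h⟩
    have hbx : b x ≠ 0 := by
      have := DFunLike.congr_fun h x
      simp only [Finsupp.add_apply, indicatorVec_apply, Finsupp.single_eq_same] at this
      split_ifs at this <;> omega
    obtain ⟨b, rfl⟩ := exists_eq_add_single hbx
    rw [add_right_comm] at h
    exact ⟨b, hb, add_right_cancel h⟩

lemma deletion_koszulComplex (hx : a x = 0) :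
    deletion (koszulComplex U (a + single x 1)) x =
      koszulComplex (monomialColon U (single x 1)) a := by
  classical
  ext τ
  constructor
  · rintro ⟨⟨b, hb, h⟩, hxτ⟩
    have hbx : b x ≠ 0 := by
      have := DFunLike.congr_fun h x
      simp [indicatorVec_apply, hxτ, hx] at this
      omega
    obtain ⟨b, rfl⟩ := exists_eq_add_single hbx
    rw [add_right_comm] at h
    exact ⟨b, hb, add_right_cancel h⟩
  · rintro ⟨b, hb, rfl⟩
    exact ⟨⟨_, hb, add_right_comm _ _ _⟩, fun hxτ => by simp [indicatorVec_apply, hxτ] at hx⟩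

lemma link_koszulComplex [DecidableEq V] (hx : a x = 0) :
    link (koszulComplex U (a + single x 1)) x = koszulComplex U a := by
  ext τ
  constructor
  · rintro ⟨hxτ, b, hb, h⟩
    rw [indicatorVec_insert hxτ, ← add_assoc] at h
    exact ⟨b, hb, add_right_cancel h⟩
  · rintro ⟨b, hb, rfl⟩
    have hxτ : x ∉ τ := fun hxτ => by simp [indicatorVec_apply, hxτ] at hx
    exact ⟨hxτ, b, hb, by rw [indicatorVec_insert hxτ, add_assoc]⟩

lemma monomialColon_single_union_variableMonomials (U : Set (V →₀ ℕ)) (hx : x ∈ W) :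
    monomialColon (U ∪ variableMonomials W) (single x 1) = Set.univ :=
  Set.eq_univ_of_forall fun b => Or.inr ⟨x, hx, by simp⟩

variable [LinearOrder V] [Fintype V] {R : Type*} [CommRing R] {p : ℕ}

lemma acyclicAt_koszulComplex_of_cone (v : V)
    (h : ∀ b ≤ a, b v = a v → b + single v 1 ∈ U → b ∈ U) :
    AcyclicAt R (koszulComplex U (a + single v 1)) p := by
  refine acyclicAt_of_cone v ?_
  rintro τ ⟨b, hb, hbτ⟩
  by_cases hv : v ∈ τ
  · exact ⟨b, hb, by rwa [Finset.insert_eq_self.2 hv]⟩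
  · have hbv : b v = a v + 1 := by
      simpa [indicatorVec_apply, hv] using DFunLike.congr_fun hbτ v
    obtain ⟨b, rfl⟩ := exists_eq_add_single (b := b) (x := v) (by omega)
    rw [add_right_comm] at hbτ
    obtain rfl := add_right_cancel hbτ
    refine ⟨b, h b le_self_add ?_ hb, by rw [indicatorVec_insert hv, add_assoc]⟩
    simpa using hbv

lemma acyclicAt_koszulComplex_univ (ha : a ≠ 0) :
    AcyclicAt R (koszulComplex Set.univ a) p := by
  obtain ⟨v, hv⟩ := Finsupp.ne_iff.1 ha
  obtain ⟨a, rfl⟩ := exists_eq_add_single hv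
  exact acyclicAt_koszulComplex_of_cone v fun _ _ _ _ => Set.mem_univ _

/-! ### The regularity of a set of monomials -/

variable (R) in
/-- The ideal spanned by the set `U` of monomials has regularity at most `r`, expressed by the
vanishing of its Koszul homology in every homological degree `p` and multidegree `a` with
`|a| - p > r`. -/
def RegularityLE (U : Set (V →₀ ℕ)) (r : ℤ) : Prop :=
  ∀ (a : V →₀ ℕ) (p : ℕ), r < (a.degree : ℤ) - p → AcyclicAt R (koszulComplex U a) p

variable (R) in
/-- The condition `RegularityLE R U r` restricted to the multidegrees that do not involve the
variables in `W`. -/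
def RegularityLEOff (W : Set V) (U : Set (V →₀ ℕ)) (r : ℤ) : Prop :=
  ∀ a : V →₀ ℕ, (∀ w ∈ W, a w = 0) → ∀ p : ℕ, r < (a.degree : ℤ) - p →
    AcyclicAt R (koszulComplex U a) p

variable {r : ℤ}

lemma regularityLEOff_empty : RegularityLEOff R ∅ U r ↔ RegularityLE R U r := by
  simp [RegularityLEOff, RegularityLE]

lemma regularityLE_univ (hr : 0 ≤ r) : RegularityLE R (Set.univ : Set (V →₀ ℕ)) r := by
  intro a p hp
  refine acyclicAt_koszulComplex_univ ?_
  rintro rfl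
  rw [map_zero] at hp
  omega

lemma RegularityLE.of_colon_of_union (hU : IsUpperSet U) (m : V →₀ ℕ)
    (hcolon : RegularityLE R (monomialColon U m) r)
    (hunion : RegularityLE R (U ∪ Set.Ici m) (r + m.degree)) :
    RegularityLE R U (r + m.degree) := by
  intro a p hp
  refine .of_inter_of_union (isLowerSet_koszulComplex hU a)
    (isLowerSet_koszulComplex (isUpperSet_Ici m) a) ?_ (koszulComplex_union ▸ hunion a p hp)
  rw [← koszulComplex_inter]
  by_cases hm : m ≤ a
  · obtain ⟨a', rfl⟩ := exists_add_of_le hm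
    rw [map_add, Nat.cast_add] at hp
    rw [add_comm m, koszulComplex_inter_Ici]
    exact hcolon a' p (by omega)
  · rw [koszulComplex_inter_Ici_of_not_le hm]
    exact acyclicAt_empty

/-- If the monomials `X ^ f i`, `i ∈ A`, all of degree `d`, are adjoined to `U` in decreasing order
of `i`, then the regularity of `U` is controlled by that of the colons met on the way. -/
lemma RegularityLE.of_colons_of_union {α : Type*} [LinearOrder α] {f : α → V →₀ ℕ} {d : ℕ}
    (hU : IsUpperSet U) (A : Finset α) (hd : ∀ i ∈ A, (f i).degree = d)
    (hcolon : ∀ i ∈ A,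
      RegularityLE R (monomialColon (U ∪ {a | ∃ j ∈ A, i < j ∧ f j ≤ a}) (f i)) r)
    (hunion : RegularityLE R (U ∪ {a | ∃ j ∈ A, f j ≤ a}) (r + d)) : RegularityLE R U (r + d) := by
  induction A using Finset.induction_on_min with
  | empty => simpa using hunion
  | insert i A hi ih =>
    refine ih (fun j hj => hd j (Finset.mem_insert_of_mem hj)) (fun j hj => ?_) ?_
    · have := hcolon j (Finset.mem_insert_of_mem hj)
      simpa only [Finset.exists_mem_insert, (hi j hj).not_gt, false_and, false_or] using this
    · have hup : IsUpperSet (U ∪ {a | ∃ j ∈ A, f j ≤ a}) :=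
        hU.union fun _ _ h ⟨j, hj, hle⟩ => ⟨j, hj, hle.trans h⟩
      rw [← hd i (Finset.mem_insert_self i A)] at hunion ⊢
      refine .of_colon_of_union hup (f i) ?_ ?_
      · have hlater (a : V →₀ ℕ) : (∃ j ∈ insert i A, i < j ∧ f j ≤ a) ↔ ∃ j ∈ A, f j ≤ a := by
          simp only [Finset.exists_mem_insert, lt_irrefl, false_and, false_or]
          exact exists_congr fun j => and_congr_right fun hj => and_iff_right (hi j hj)
        simpa only [hlater] using hcolon i (Finset.mem_insert_self i A)
      · convert hunion using 1
        ext a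
        simp only [Set.mem_union, Set.mem_ofPred_eq, Finset.exists_mem_insert, Set.mem_Ici]
        exact or_assoc.trans (or_congr_right or_comm)

lemma RegularityLE.inter (hU : IsUpperSet U) (hU' : IsUpperSet U') (h : RegularityLE R U r)
    (h' : RegularityLE R U' r) (hunion : RegularityLE R (U ∪ U') (r - 1)) :
    RegularityLE R (U ∩ U') r := by
  intro a p hp
  rw [koszulComplex_inter]
  refine (h a p hp).inter (isLowerSet_koszulComplex hU a) (isLowerSet_koszulComplex hU' a)
    (h' a p hp) ?_
  rw [← koszulComplex_union]
  exact hunion a (p + 1) (by push_cast; omega)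

lemma RegularityLE.monomialColon_single (hU : IsUpperSet U) (h : RegularityLE R U r) (x : V) :
    RegularityLE R (monomialColon U (single x 1)) r := by
  intro a p hp
  have hbig : AcyclicAt R (koszulComplex U (a + single x 1)) p :=
    h _ p (by rw [map_add, Finsupp.degree_single]; push_cast; omega)
  by_cases hx : a x = 0
  · rw [← deletion_koszulComplex hx]
    refine acyclicAt_deletion (isLowerSet_koszulComplex hU _) hbig ?_
    rw [link_koszulComplex hx]
    exact h a p hp
  · rwa [koszulComplex_monomialColon_single_of_ne_zero hx]

lemma RegularityLEOff.union_variable (hr : 1 ≤ r) (hU : IsUpperSet U)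
    (h : RegularityLEOff R (insert x W) U r) :
    RegularityLEOff R W (U ∪ variableMonomials {x}) r := by
  intro a ha p hp
  by_cases hx : a x = 0
  · rw [koszulComplex_union_variableMonomials (by simpa using hx)]
    exact h a (by simpa [hx] using ha) p hp
  obtain ⟨a, rfl⟩ := exists_eq_add_single hx
  rw [map_add, Finsupp.degree_single, Nat.cast_add, Nat.cast_one] at hp
  by_cases hax : a x = 0
  · refine acyclicAt_of_deletion_of_link
      (isLowerSet_koszulComplex (hU.union (isUpperSet_variableMonomials _)) _) (x := x) ?_ ?_
    · rw [deletion_koszulComplex hax,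
        monomialColon_single_union_variableMonomials U (Set.mem_singleton x)]
      refine acyclicAt_koszulComplex_univ ?_
      rintro rfl
      rw [map_zero] at hp
      omega
    · rintro q rfl
      have haW : ∀ w ∈ insert x W, a w = 0 := by
        simpa [hax] using fun w hw => Nat.eq_zero_of_add_eq_zero_right (ha w hw)
      rw [link_koszulComplex hax, koszulComplex_union_variableMonomials (by simpa using hax)]
      exact h a haW q (by push_cast at hp; omega)
  · exact acyclicAt_koszulComplex_of_cone x fun b _ hb _ => Or.inr ⟨x, rfl, hb ▸ hax⟩

lemma RegularityLEOff.union_variableMonomials (hr : 1 ≤ r) (hU : IsUpperSet U)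
    (h : RegularityLEOff R W U r) : RegularityLE R (U ∪ variableMonomials W) r := by
  induction W, W.toFinite using Set.Finite.induction_on generalizing U with
  | empty => simpa [variableMonomials] using regularityLEOff_empty.1 h
  | @insert w W _ _ ih =>
    have hunion : U ∪ variableMonomials (insert w W) =
        U ∪ variableMonomials {w} ∪ variableMonomials W := by
      ext b
      simp [variableMonomials, or_assoc]
    rw [hunion]
    exact ih (hU.union (isUpperSet_variableMonomials _)) (h.union_variable hr hU)

end MonomialKoszulComplexes

section EdgeMonomials

/-! ### Ideals of quadratic monomials -/

variable {V : Type*} {E : V → V → Prop} {a : V →₀ ℕ} {u v : V}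

/-- The exponents of the monomials divisible by `x_u x_v` for some `u`, `v` with `E u v`; a loop
`E u u` stands for the variable `x_u`. -/
def edgeMonomials (E : V → V → Prop) : Set (V →₀ ℕ) := {a | ∃ u v, E u v ∧ a u ≠ 0 ∧ a v ≠ 0}

lemma isUpperSet_edgeMonomials : IsUpperSet (edgeMonomials E) :=
  fun _ _ h ⟨u, v, huv, hu, hv⟩ => ⟨u, v, huv, (Nat.pos_of_ne_zero hu |>.trans_le (h u)).ne',
    (Nat.pos_of_ne_zero hv |>.trans_le (h v)).ne'⟩

lemma monomialColon_edgeMonomials_single (hE : ∀ ⦃x y⦄, E x y → E y x) (hu : ¬ E u u) :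
    monomialColon (edgeMonomials E) (single u 1) =
      edgeMonomials E ∪ variableMonomials {x | E u x} := by
  classical
  ext b
  constructor
  · rintro ⟨x, y, hxy, hx, hy⟩
    by_cases hux : u = x
    · subst hux
      have huy : u ≠ y := fun h => hu (h ▸ hxy)
      exact .inr ⟨y, hxy, by simpa [huy] using hy⟩
    by_cases huy : u = y
    · subst huy
      exact .inr ⟨x, hE hxy, by simpa [hux] using hx⟩
    · exact .inl ⟨x, y, hxy, by simpa [hux] using hx, by simpa [huy] using hy⟩
  · rintro (h | ⟨x, hx, hbx⟩)
    · exact isUpperSet_edgeMonomials le_self_add h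
    · exact ⟨u, x, hx, by simp, by simp [hbx]⟩

variable [LinearOrder V] [Fintype V] {R : Type*} [CommRing R] {r : ℤ}

lemma RegularityLE.two_le_of_edge [Nontrivial R] (h : RegularityLE R (edgeMonomials E) r)
    (huv : E u v) (hu : ¬ E u u) (hv : ¬ E v v) : 2 ≤ r := by
  by_contra! hr
  have hempty : ∅ ∈ koszulComplex (edgeMonomials E) (single u 1 + single v 1) :=
    ⟨single u 1 + single v 1, ⟨u, v, huv, by simp, by simp⟩, by simp [indicatorVec]⟩
  have hacyclic := h (single u 1 + single v 1) 0 (by simpa using hr)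
  obtain ⟨z, b, ⟨x, y, hxy, hx, hy⟩, hb⟩ := hacyclic.exists_singleton_mem hempty
  have hdegree : b.degree = 1 := by simpa [degree_indicatorVec] using congrArg Finsupp.degree hb
  obtain ⟨w, rfl⟩ := (Finsupp.sum_eq_one_iff b).1 hdegree
  obtain rfl : w = x := by by_contra hne; simp [hne] at hx
  obtain rfl : w = y := by by_contra hne; simp [hne] at hy
  have hw : w = u ∨ w = v := by
    by_contra! hw
    simpa [hw.1.symm, hw.2.symm] using DFunLike.congr_fun hb w
  rcases hw with rfl | rfl
  exacts [hu hxy, hv hxy]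

/-- The complex in multidegree `a` is the link of `v` in the deletion of `u` from the complex in
multidegree `a + e_u + e_v`; the complementary link and deletion are cones. -/
lemma RegularityLE.off_neighbors (h : RegularityLE R (edgeMonomials E) r)
    (hE : ∀ ⦃x y⦄, E x y → E y x) (huv : E u v) (hu : ¬ E u u) (hv : ¬ E v v) :
    RegularityLEOff R {x | E u x ∨ E v x} (edgeMonomials E) (r - 1) := by
  intro a ha p hp
  have hau : a u = 0 := ha u (.inr (hE huv))
  have hav : a v = 0 := ha v (.inl huv)
  have huv' : v ≠ u := fun h => hu (h ▸ huv)
  rcases eq_or_ne a 0 with rfl | ha0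
  · rw [show koszulComplex (edgeMonomials E) 0 = ∅ from Set.eq_empty_of_forall_notMem fun τ hτ => by
      obtain ⟨b, ⟨x, y, -, hx, -⟩, hb⟩ := hτ
      exact hx (Nat.eq_zero_of_add_eq_zero_right (DFunLike.congr_fun hb x))]
    exact acyclicAt_empty
  have hup := isUpperSet_edgeMonomials (E := E)
  have hauv : (a + (single v 1 : V →₀ ℕ)) u = 0 := by simp [hau, huv']
  have hdel : AcyclicAt R (koszulComplex (monomialColon (edgeMonomials E) (single u 1))
      (a + single v 1)) (p + 1) := by
    rw [← deletion_koszulComplex hauv]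
    refine acyclicAt_deletion (isLowerSet_koszulComplex hup _) (h _ _ ?_) ?_
    · simp only [map_add, Finsupp.degree_single]
      push_cast
      omega
    · rw [link_koszulComplex hauv]
      refine acyclicAt_koszulComplex_of_cone v fun b hb _ hbv => ?_
      rcases (monomialColon_edgeMonomials_single hE hv).le hbv with hb' | ⟨x, hx, hbx⟩
      · exact hb'
      · exact absurd (Nat.eq_zero_of_le_zero ((hb x).trans (ha x (.inr hx)).le)) hbx
  have huniv : monomialColon (monomialColon (edgeMonomials E) (single u 1)) (single v 1) =
      Set.univ := Set.eq_univ_of_forall fun b => ⟨u, v, huv, by simp, by simp⟩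
  have hlink := acyclicAt_link (isLowerSet_koszulComplex (isUpperSet_monomialColon hup _) _) hdel
    (by rw [deletion_koszulComplex hav, huniv]; exact acyclicAt_koszulComplex_univ ha0)
  rwa [link_koszulComplex hav, monomialColon_edgeMonomials_single hE hu,
    koszulComplex_union_variableMonomials (W := {x | E u x}) fun w hw => ha w (.inl hw)] at hlink

lemma RegularityLE.inter_colon_edge [Nontrivial R] (h : RegularityLE R (edgeMonomials E) r)
    (hE : ∀ ⦃x y⦄, E x y → E y x) (huv : E u v) (hu : ¬ E u u) (hv : ¬ E v v) :
    RegularityLE R (monomialColon (edgeMonomials E) (single u 1) ∩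
      monomialColon (edgeMonomials E) (single v 1)) r := by
  have hr := h.two_le_of_edge huv hu hv
  have hup := isUpperSet_edgeMonomials (E := E)
  refine .inter (isUpperSet_monomialColon hup _) (isUpperSet_monomialColon hup _)
    (h.monomialColon_single hup u) (h.monomialColon_single hup v) ?_
  have hunion : monomialColon (edgeMonomials E) (single u 1) ∪
      monomialColon (edgeMonomials E) (single v 1) =
      edgeMonomials E ∪ variableMonomials {x | E u x ∨ E v x} := by
    rw [monomialColon_edgeMonomials_single hE hu, monomialColon_edgeMonomials_single hE hv,
      Set.union_union_union_comm, Set.union_self]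
    congr 1
    ext b
    simp only [variableMonomials, Set.mem_union, Set.mem_ofPred_eq, or_and_right, exists_or]
  rw [hunion]
  exact (h.off_neighbors hE huv hu hv).union_variableMonomials (by omega) hup

end EdgeMonomials

section EdgeProducts

/-! ### Products of edges -/

variable {V ι : Type*} [Fintype ι] {d d' : ι → V} {C : Finset V} {x : V}

/-- The exponent of the monomial `∏ l, X (d l)`. -/
def prodVec (d : ι → V) : V →₀ ℕ := ∑ l, single (d l) 1

lemma prodVec_apply [DecidableEq V] (d : ι → V) (x : V) :
    prodVec d x = (Finset.univ.filter (d · = x)).card := by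
  simp [prodVec, Finsupp.finsetSum_apply, Finsupp.single_apply]

lemma prodVec_apply_eq_zero (h : ∀ l, d l ≠ x) : prodVec d x = 0 := by
  classical
  rw [prodVec_apply, Finset.card_eq_zero, Finset.filter_eq_empty_iff]
  exact fun l _ => h l

lemma degree_prodVec (d : ι → V) : (prodVec d).degree = Fintype.card ι := by
  simp [prodVec, Finsupp.degree_single]

lemma sum_prodVec [DecidableEq V] (C : Finset V) (d : ι → V) :
    ∑ x ∈ C, prodVec d x = ∑ l, if d l ∈ C then 1 else 0 := by
  simp only [prodVec, Finsupp.finsetSum_apply, Finsupp.single_apply]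
  rw [Finset.sum_comm]
  exact Finset.sum_congr rfl fun l _ => by simp

lemma prodVec_comp_equiv (d : ι → V) (π : ι ≃ ι) : prodVec (d ∘ π) = prodVec d :=
  Equiv.sum_comp π fun l => single (d l) 1

lemma exists_comp_equiv_of_prodVec_eq (h : prodVec d = prodVec d') : ∃ π : ι ≃ ι, d' ∘ π = d := by
  classical
  have hfiber (x : V) : Nonempty ({l // d l = x} ≃ {l // d' l = x}) := by
    refine ⟨Fintype.equivOfCardEq ?_⟩
    have := DFunLike.congr_fun h x
    rwa [prodVec_apply, prodVec_apply, ← Fintype.card_subtype, ← Fintype.card_subtype] at this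
  have e (x : V) : {l // d l = x} ≃ {l // d' l = x} := (hfiber x).some
  refine ⟨(Equiv.sigmaFiberEquiv d).symm.trans
    ((Equiv.sigmaCongrRight e).trans (Equiv.sigmaFiberEquiv d')), funext fun l => ?_⟩
  exact (e (d l) ⟨l, rfl⟩).2

lemma prodVec_update [DecidableEq ι] (d : ι → V) (l : ι) (x : V) :
    prodVec (Function.update d l x) + single (d l) 1 = prodVec d + single x 1 := by
  have hrest : ∑ i ∈ Finset.univ.erase l, (single (Function.update d l x i) 1 : V →₀ ℕ) =
      ∑ i ∈ Finset.univ.erase l, single (d i) 1 :=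
    Finset.sum_congr rfl fun i hi => by rw [Function.update_of_ne (Finset.ne_of_mem_erase hi)]
  rw [prodVec, prodVec, ← Finset.add_sum_erase _ _ (Finset.mem_univ l), hrest,
    ← Finset.add_sum_erase _ (fun i => single (d i) 1) (Finset.mem_univ l), Function.update_self]
  abel

/-- Replace a factor `d' l = y` of `d'` by `d l = x`. Unless `d` has fewer factors `y` than `d'`,
the new family has fewer factors `y` than `d`, and the exchange is repeated with `y` for `x`. -/
lemma exists_prodVec_exchange (h : prodVec d' x < prodVec d x) :
    ∃ (d'' : ι → V) (y : V), (∀ l, d'' l = d l ∨ d'' l = d' l) ∧ prodVec d y < prodVec d' y ∧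
      prodVec d'' + single y 1 = prodVec d' + single x 1 := by
  classical
  induction hn : (Finset.univ.filter fun l => d l ≠ d' l).card using Nat.strong_induction_on
    generalizing d' x with
  | _ n ih =>
    obtain ⟨l, hl, hl'⟩ : ∃ l, d l = x ∧ d' l ≠ x := by
      by_contra! hcon
      rw [prodVec_apply, prodVec_apply] at h
      exact h.not_ge (Finset.card_le_card (Finset.monotone_filter_right _ fun l _ => hcon l))
    have hupdate := prodVec_update d' l x
    have hmix (l') : Function.update d' l x l' = d l' ∨ Function.update d' l x l' = d' l' := by
      rcases eq_or_ne l' l with rfl | hne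
      · exact .inl (by rw [Function.update_self, hl])
      · exact .inr (Function.update_of_ne hne _ _)
    by_cases hy : prodVec d (d' l) < prodVec d' (d' l)
    · exact ⟨_, d' l, hmix, hy, hupdate⟩
    have hcount (z : V) : prodVec (Function.update d' l x) z + (if d' l = z then 1 else 0) =
        prodVec d' z + if x = z then 1 else 0 := by
      simpa [Finsupp.single_apply] using DFunLike.congr_fun hupdate z
    have hlt : prodVec (Function.update d' l x) (d' l) < prodVec d (d' l) := by
      have := hcount (d' l)
      rw [if_pos rfl, if_neg hl'.symm] at this
      omega
    have hcloser : (Finset.univ.filter fun i => d i ≠ Function.update d' l x i) ⊂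
        Finset.univ.filter fun i => d i ≠ d' i := by
      refine Finset.ssubset_iff_of_subset (fun i => ?_) |>.2 ⟨l, by simpa [hl] using hl'.symm, ?_⟩
      · simpa using fun hi hi' => hi ((hmix i).elim Eq.symm fun h => hi'.trans h.symm)
      · simp [hl]
    obtain ⟨d'', z, hmix', hz, hsum⟩ := ih _ (hn ▸ Finset.card_lt_card hcloser) hlt rfl
    refine ⟨d'', z, fun i => ?_, ?_, hsum.trans hupdate⟩
    · rcases hmix' i with hi | hi
      · exact .inl hi
      · rw [hi]
        exact hmix i
    · have := hcount z
      split_ifs at this with h₁ h₂ h₂ <;> subst_vars <;> omega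

variable (G : SimpleGraph V) {s : ℕ} {m m' : V →₀ ℕ} {u v : V}

/-- `m` is the exponent of a product of `s` edges of `G`. -/
def IsEdgeProduct (s : ℕ) (m : V →₀ ℕ) : Prop :=
  ∃ u v : Fin s → V, (∀ l, G.Adj (u l) (v l)) ∧ m = prodVec u + prodVec v

/-- The monomials of the `s`-th power of the edge ideal. -/
def powerMonomials (s : ℕ) : Set (V →₀ ℕ) := {a | ∃ m, IsEdgeProduct G s m ∧ m ≤ a}

/-- The monomials of the `t`-th symbolic power of the edge ideal. -/
def symbolicMonomials (t : ℕ) : Set (V →₀ ℕ) :=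
  {a | ∀ C : Finset V, G.IsVertexCover C → t ≤ ∑ x ∈ C, a x}

variable {G}

lemma isUpperSet_powerMonomials (s : ℕ) : IsUpperSet (powerMonomials G s) :=
  fun _ _ h ⟨m, hm, hle⟩ => ⟨m, hm, hle.trans h⟩

lemma isUpperSet_symbolicMonomials (t : ℕ) : IsUpperSet (symbolicMonomials G t) :=
  fun _ _ h ha C hC => (ha C hC).trans (Finset.sum_le_sum fun x _ => h x)

lemma isEdgeProduct_zero : IsEdgeProduct G 0 m ↔ m = 0 := by
  refine ⟨fun ⟨u, v, _, hm⟩ => by simpa [prodVec] using hm, ?_⟩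
  rintro rfl
  exact ⟨Fin.elim0, Fin.elim0, fun l => l.elim0, by simp [prodVec]⟩

lemma isEdgeProduct_succ : IsEdgeProduct G (s + 1) m ↔
    ∃ m' u v, IsEdgeProduct G s m' ∧ G.Adj u v ∧ m = m' + (single u 1 + single v 1) := by
  constructor
  · rintro ⟨u, v, huv, rfl⟩
    refine ⟨_, u (.last s), v (.last s), ⟨Fin.init u, Fin.init v, fun l => huv _, rfl⟩, huv _, ?_⟩
    simp only [prodVec, Fin.sum_univ_castSucc, Fin.init]
    abel
  · rintro ⟨_, x, y, ⟨u, v, huv, rfl⟩, hxy, rfl⟩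
    refine ⟨Fin.snoc u x, Fin.snoc v y, Fin.lastCases (by simpa using hxy) (by simpa using huv), ?_⟩
    simp only [prodVec, Fin.sum_univ_castSucc, Fin.snoc_castSucc, Fin.snoc_last]
    abel

lemma IsEdgeProduct.degree_eq (h : IsEdgeProduct G s m) : m.degree = 2 * s := by
  obtain ⟨u, v, _, rfl⟩ := h
  rw [map_add, degree_prodVec, degree_prodVec, Fintype.card_fin, two_mul]

lemma finite_setOf_isEdgeProduct [Finite V] (s : ℕ) : {m | IsEdgeProduct G s m}.Finite :=
  (Finsupp.finite_of_degree_eq (2 * s)).subset fun _ hm => hm.degree_eq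

lemma sum_prodVec_add_prodVec_of_isVertexCover [DecidableEq V] (hC : G.IsVertexCover C)
    {u v : Fin s → V} (huv : ∀ l, G.Adj (u l) (v l)) :
    ∑ x ∈ C, (prodVec u + prodVec v) x =
      s + (Finset.univ.filter fun l => u l ∈ C ∧ v l ∈ C).card := by
  have hmeet (l : Fin s) : ((if u l ∈ C then 1 else 0) + if v l ∈ C then 1 else 0) =
      1 + if u l ∈ C ∧ v l ∈ C then 1 else 0 := by
    rcases hC (huv l) with h | h <;> rw [Finset.mem_coe] at h <;> simp [h, add_comm]
  simp only [Finsupp.add_apply, Finset.sum_add_distrib, sum_prodVec]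
  rw [← Finset.sum_add_distrib, Finset.sum_congr rfl fun l _ => hmeet l, Finset.sum_add_distrib,
    Finset.sum_boole]
  simp

lemma IsEdgeProduct.le_sum (hC : G.IsVertexCover C) (h : IsEdgeProduct G s m) :
    s ≤ ∑ x ∈ C, m x := by
  classical
  obtain ⟨u, v, huv, rfl⟩ := h
  rw [sum_prodVec_add_prodVec_of_isVertexCover hC huv]
  exact Nat.le_add_right _ _

lemma IsEdgeProduct.exists_eq_prodVec_add_prodVec (hC : G.IsVertexCover C)
    (hm : IsEdgeProduct G s m) (hs : ∑ x ∈ C, m x ≤ s) :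
    ∃ c d : Fin s → V, (∀ l, G.Adj (c l) (d l)) ∧ (∀ l, c l ∈ C) ∧ (∀ l, d l ∉ C) ∧
      m = prodVec c + prodVec d := by
  classical
  obtain ⟨u, v, huv, rfl⟩ := hm
  rw [sum_prodVec_add_prodVec_of_isVertexCover hC huv, add_le_iff_nonpos_right,
    nonpos_iff_eq_zero, Finset.card_eq_zero, Finset.filter_eq_empty_iff] at hs
  have hcover (l : Fin s) : u l ∈ C ∨ v l ∈ C := hC (huv l)
  refine ⟨fun l => if u l ∈ C then u l else v l, fun l => if u l ∈ C then v l else u l,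
    fun l => ?_, fun l => ?_, fun l => ?_, ?_⟩
  · dsimp only
    split_ifs
    exacts [huv l, (huv l).symm]
  · dsimp only
    split_ifs with hu
    exacts [hu, (hcover l).resolve_left hu]
  · dsimp only
    split_ifs with hu
    exacts [fun hv => hs (Finset.mem_univ l) ⟨hu, hv⟩, hu]
  · rw [prodVec, prodVec, prodVec, prodVec, ← Finset.sum_add_distrib, ← Finset.sum_add_distrib]
    refine Finset.sum_congr rfl fun l _ => ?_
    split_ifs
    exacts [rfl, add_comm _ _]

lemma exists_common_prodVec (hC : G.IsVertexCover C) (hm : IsEdgeProduct G s m)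
    (hm' : IsEdgeProduct G s m') (hs : ∑ x ∈ C, (m ⊔ m') x ≤ s) :
    ∃ c d d' : Fin s → V, (∀ l, G.Adj (c l) (d l)) ∧ (∀ l, G.Adj (c l) (d' l)) ∧
      m = prodVec c + prodVec d ∧ m' = prodVec c + prodVec d' := by
  have hle : ∑ x ∈ C, m x ≤ ∑ x ∈ C, (m ⊔ m') x := Finset.sum_le_sum fun x _ => by simp
  have hle' : ∑ x ∈ C, m' x ≤ ∑ x ∈ C, (m ⊔ m') x := Finset.sum_le_sum fun x _ => by simp
  have hge := hm.le_sum hC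
  have hge' := hm'.le_sum hC
  have heq : ∀ z ∈ C, m z = (m ⊔ m') z :=
    (Finset.sum_eq_sum_iff_of_le fun x _ => by simp).1 (by omega)
  have heq' : ∀ z ∈ C, m' z = (m ⊔ m') z :=
    (Finset.sum_eq_sum_iff_of_le fun x _ => by simp).1 (by omega)
  obtain ⟨c, d, hcd, hc, hd, rfl⟩ := hm.exists_eq_prodVec_add_prodVec hC (hle.trans hs)
  obtain ⟨c', d', hcd', hc', hd', rfl⟩ := hm'.exists_eq_prodVec_add_prodVec hC (hle'.trans hs)
  have hcc' : prodVec c = prodVec c' := by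
    ext z
    by_cases hz : z ∈ C
    · have hzz := (heq z hz).trans (heq' z hz).symm
      rwa [Finsupp.add_apply, Finsupp.add_apply,
        prodVec_apply_eq_zero fun l (h : d l = z) => hd l (h ▸ hz),
        prodVec_apply_eq_zero fun l (h : d' l = z) => hd' l (h ▸ hz)] at hzz
    · rw [prodVec_apply_eq_zero fun l (h : c l = z) => hz (h ▸ hc l),
        prodVec_apply_eq_zero fun l (h : c' l = z) => hz (h ▸ hc' l)]
  obtain ⟨π, rfl⟩ := exists_comp_equiv_of_prodVec_eq hcc'
  exact ⟨c' ∘ π, d, d' ∘ π, hcd, fun l => hcd' _, rfl, by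
    rw [prodVec_comp_equiv, prodVec_comp_equiv]⟩

lemma IsEdgeProduct.exists_exchange (hm : IsEdgeProduct G s m) (hm' : IsEdgeProduct G s m')
    (hsup : m ⊔ m' ∉ symbolicMonomials G (s + 1)) (hx : m' x < m x) :
    ∃ m'' y, IsEdgeProduct G s m'' ∧ m y < m' y ∧ m'' + single y 1 = m' + single x 1 := by
  simp only [symbolicMonomials, Set.mem_ofPred_eq, not_forall, not_le, Nat.lt_succ_iff] at hsup
  obtain ⟨C, hC, hs⟩ := hsup
  obtain ⟨c, d, d', hcd, hcd', rfl, rfl⟩ := exists_common_prodVec hC hm hm' hs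
  obtain ⟨d'', y, hmix, hy, hsum⟩ := exists_prodVec_exchange (d := d) (d' := d') (x := x)
    (by simpa using hx)
  refine ⟨prodVec c + prodVec d'', y, ⟨c, d'', fun l => ?_, rfl⟩, by simpa using hy, ?_⟩
  · rcases hmix l with hl | hl <;> rw [hl]
    exacts [hcd l, hcd' l]
  · rw [add_assoc, hsum, add_assoc]

end EdgeProducts

section SymbolicColon

/-! ### Colons of symbolic powers by products of edges -/

variable {V : Type*} {G : SimpleGraph V} {U : Set (V →₀ ℕ)} {s : ℕ} {m m' b : V →₀ ℕ} {u v z : V}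

variable (G) in
/-- `U` consists of all monomials, or of those of an ideal which contains the edge ideal of `G` and
is generated by variables and products of two distinct variables. -/
def IsQuadraticOver (U : Set (V →₀ ℕ)) : Prop :=
  U = Set.univ ∨ ∃ E : V → V → Prop, (∀ ⦃x y⦄, E x y → E y x) ∧ (∀ ⦃x y⦄, G.Adj x y → E x y) ∧
    U = edgeMonomials E

lemma monomialColon_edgeMonomials_single_of_loop {E : V → V → Prop} (hz : E z z) :
    monomialColon (edgeMonomials E) (single z 1) = Set.univ :=
  Set.eq_univ_of_forall fun _ => ⟨z, z, hz, by simp, by simp⟩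

lemma IsQuadraticOver.monomialColon_single (hU : IsQuadraticOver G U) (z : V) :
    IsQuadraticOver G (monomialColon U (single z 1)) := by
  rcases hU with rfl | ⟨E, hE, hG, rfl⟩
  · exact .inl rfl
  by_cases hz : E z z
  · exact .inl (monomialColon_edgeMonomials_single_of_loop hz)
  refine .inr ⟨fun x y => E x y ∨ x = y ∧ E z x, ?_, fun x y h => .inl (hG h), ?_⟩
  · rintro x y (h | ⟨rfl, h⟩)
    exacts [.inl (hE h), .inr ⟨rfl, h⟩]
  · rw [monomialColon_edgeMonomials_single hE hz]
    ext b
    constructor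
    · rintro (⟨x, y, hxy, hx, hy⟩ | ⟨x, hx, hb⟩)
      exacts [⟨x, y, .inl hxy, hx, hy⟩, ⟨x, x, .inr ⟨rfl, hx⟩, hb, hb⟩]
    · rintro ⟨x, y, hxy | ⟨-, hx⟩, hbx, hby⟩
      exacts [.inl ⟨x, y, hxy, hbx, hby⟩, .inr ⟨x, hx, hbx⟩]

lemma IsQuadraticOver.inter_monomialColon_single (hU : IsQuadraticOver G U) (u v : V) :
    IsQuadraticOver G (monomialColon U (single u 1) ∩ monomialColon U (single v 1)) := by
  rcases hU with rfl | ⟨E, hE, hG, rfl⟩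
  · exact .inl (Set.univ_inter _)
  have hquad : IsQuadraticOver G (edgeMonomials E) := .inr ⟨E, hE, hG, rfl⟩
  by_cases hu : E u u
  · rw [monomialColon_edgeMonomials_single_of_loop hu, Set.univ_inter]
    exact hquad.monomialColon_single v
  by_cases hv : E v v
  · rw [monomialColon_edgeMonomials_single_of_loop hv, Set.inter_univ]
    exact hquad.monomialColon_single u
  refine .inr ⟨fun x y => E x y ∨ E u x ∧ E v y ∨ E v x ∧ E u y, ?_, fun x y h => .inl (hG h), ?_⟩
  · rintro x y (h | ⟨hx, hy⟩ | ⟨hx, hy⟩)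
    exacts [.inl (hE h), .inr (.inr ⟨hy, hx⟩), .inr (.inl ⟨hy, hx⟩)]
  · rw [monomialColon_edgeMonomials_single hE hu, monomialColon_edgeMonomials_single hE hv,
      ← Set.union_inter_distrib_left]
    ext b
    constructor
    · rintro (⟨x, y, hxy, hx, hy⟩ | ⟨⟨x, hx, hbx⟩, y, hy, hby⟩)
      exacts [⟨x, y, .inl hxy, hx, hy⟩, ⟨x, y, .inr (.inl ⟨hx, hy⟩), hbx, hby⟩]
    · rintro ⟨x, y, hxy | ⟨hx, hy⟩ | ⟨hx, hy⟩, hbx, hby⟩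
      exacts [.inl ⟨x, y, hxy, hbx, hby⟩, .inr ⟨⟨x, hx, hbx⟩, y, hy, hby⟩,
        .inr ⟨⟨y, hy, hby⟩, x, hx, hbx⟩]

lemma symbolicMonomials_one [Finite V] : symbolicMonomials G 1 = edgeMonomials G.Adj := by
  classical
  have := Fintype.ofFinite V
  ext b
  constructor
  · intro h
    by_contra hb
    have hC : G.IsVertexCover (Finset.univ.filter (b · = 0) : Finset V) := by
      intro x y hxy
      by_contra! hn
      exact hb ⟨x, y, hxy, by simpa using hn.1, by simpa using hn.2⟩
    have hsum := h _ hC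
    rw [Finset.sum_eq_zero fun x hx => (Finset.mem_filter.1 hx).2] at hsum
    exact Nat.not_succ_le_zero 0 hsum
  · rintro ⟨x, y, hxy, hx, hy⟩ C hC
    rw [Nat.one_le_iff_ne_zero, Ne, Finset.sum_eq_zero_iff, not_forall]
    rcases hC hxy with h | h
    exacts [⟨x, fun h' => hx (h' h)⟩, ⟨y, fun h' => hy (h' h)⟩]

/-- A vertex cover containing both `u` and `v` imposes no condition on either side; one containing
a single endpoint imposes the same condition on both sides. -/
lemma monomialColon_symbolicMonomials_add_edge (hm : IsEdgeProduct G s m) (huv : G.Adj u v) :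
    monomialColon (symbolicMonomials G (s + 2)) (m + (single u 1 + single v 1)) =
      monomialColon (monomialColon (symbolicMonomials G (s + 1)) m) (single u 1) ∩
        monomialColon (monomialColon (symbolicMonomials G (s + 1)) m) (single v 1) := by
  classical
  ext b
  change (∀ C : Finset V, _ → _) ↔ (∀ C : Finset V, _ → _) ∧ ∀ C : Finset V, _ → _
  simp only [← forall_and, Finsupp.add_apply, Finset.sum_add_distrib, Finsupp.single_apply,
    Finset.sum_ite_eq]
  refine forall₂_congr fun C hC => ?_
  have := hm.le_sum hC
  rcases hC huv with h | h <;> rw [Finset.mem_coe] at h <;> simp only [h, if_true] <;>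
    split_ifs <;> omega

variable [LinearOrder V]

/-- The products of edges are ordered lexicographically, so that among the generators above `m`
only those obtained by exchanging one factor matter for the colon by `m`. -/
lemma exists_lex_lt_isEdgeProduct {m m' : Lex (V →₀ ℕ)} (hm : IsEdgeProduct G s (ofLex m))
    (hm' : IsEdgeProduct G s (ofLex m')) (hlt : m < m')
    (hsup : ofLex m' ⊔ ofLex m ∉ symbolicMonomials G (s + 1)) :
    ∃ (m'' : Lex (V →₀ ℕ)) (x : V), IsEdgeProduct G s (ofLex m'') ∧ m < m'' ∧
      ofLex m x < ofLex m' x ∧ ofLex m'' ≤ single x 1 + ofLex m := by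
  obtain ⟨x, hx, hxlt⟩ := Finsupp.Lex.lt_iff.1 hlt
  obtain ⟨m'', y, hm'', hy, hsum⟩ := hm'.exists_exchange hm hsup hxlt
  have hyx : y ≠ x := fun h => hy.not_gt (h ▸ hxlt)
  refine ⟨toLex m'', x, hm'', Finsupp.Lex.lt_iff.2 ⟨x, fun z hz => ?_, ?_⟩, hxlt, ?_⟩
  · have hyz : y ≠ z := fun h => hy.ne' (by rw [h]; exact hx z hz)
    simpa [Finsupp.single_apply, hyz, hz.ne'] using (DFunLike.congr_fun hsum z).symm
  · have := DFunLike.congr_fun hsum x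
    simp [hyx] at this
    change ofLex m x < m'' x
    omega
  · rw [add_comm, ← hsum]
    exact le_self_add

variable (G s) in
/-- The monomials divisible by a product of `s` edges of `G` that is lexicographically larger than
`m`. -/
def laterMonomials (m : Lex (V →₀ ℕ)) : Set (V →₀ ℕ) :=
  {a | ∃ m' : Lex (V →₀ ℕ), IsEdgeProduct G s (ofLex m') ∧ m < m' ∧ ofLex m' ≤ a}

lemma isUpperSet_laterMonomials (m : Lex (V →₀ ℕ)) : IsUpperSet (laterMonomials G s m) :=
  fun _ _ h ⟨m', hm', hlt, hle⟩ => ⟨m', hm', hlt, hle.trans h⟩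

lemma monomialColon_union_laterMonomials {m : Lex (V →₀ ℕ)} (hm : IsEdgeProduct G s (ofLex m)) :
    monomialColon (symbolicMonomials G (s + 1) ∪ laterMonomials G s m) (ofLex m) =
      monomialColon (symbolicMonomials G (s + 1)) (ofLex m) ∪
        variableMonomials {w | single w 1 + ofLex m ∈ laterMonomials G s m} := by
  ext b
  constructor
  · intro hb
    by_cases hsymb : b + ofLex m ∈ symbolicMonomials G (s + 1)
    · exact .inl hsymb
    obtain ⟨m', hm', hlt, hle⟩ := hb.resolve_left hsymb
    have hsup : ofLex m' ⊔ ofLex m ∉ symbolicMonomials G (s + 1) := fun h =>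
      hsymb (isUpperSet_symbolicMonomials _ (sup_le hle le_add_self) h)
    obtain ⟨m'', x, hm'', hlt', hx, hle'⟩ := exists_lex_lt_isEdgeProduct hm hm' hlt hsup
    have hbx := hx.trans_le (hle x)
    rw [Finsupp.add_apply] at hbx
    exact .inr ⟨x, ⟨m'', hm'', hlt', hle'⟩, by omega⟩
  · rintro (hb | ⟨w, hw, hbw⟩)
    · exact .inl hb
    · refine .inr (isUpperSet_laterMonomials m (add_le_add_left ?_ _) hw)
      simpa using Nat.one_le_iff_ne_zero.2 hbw

variable [Fintype V] {R : Type*} [CommRing R] {r : ℤ}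

lemma RegularityLE.inter_monomialColon_of_isQuadraticOver [Nontrivial R] (h : RegularityLE R U r)
    (hr : 0 ≤ r) (hU : IsQuadraticOver G U) (huv : G.Adj u v) :
    RegularityLE R (monomialColon U (single u 1) ∩ monomialColon U (single v 1)) r := by
  rcases hU with rfl | ⟨E, hE, hG, rfl⟩
  · have huniv (z : V) : monomialColon Set.univ (single z 1) = Set.univ := rfl
    rw [huniv, huniv, Set.univ_inter]
    exact regularityLE_univ hr
  by_cases hu : E u u
  · rw [monomialColon_edgeMonomials_single_of_loop hu, Set.univ_inter]
    exact h.monomialColon_single isUpperSet_edgeMonomials v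
  by_cases hv : E v v
  · rw [monomialColon_edgeMonomials_single_of_loop hv, Set.inter_univ]
    exact h.monomialColon_single isUpperSet_edgeMonomials u
  exact h.inter_colon_edge hE (hG huv) hu hv

lemma RegularityLE.monomialColon_symbolicMonomials [Nontrivial R]
    (h : RegularityLE R (edgeMonomials G.Adj) r) (hr : 0 ≤ r) (hm : IsEdgeProduct G s m) :
    RegularityLE R (monomialColon (symbolicMonomials G (s + 1)) m) r := by
  suffices RegularityLE R (monomialColon (symbolicMonomials G (s + 1)) m) r ∧
    IsQuadraticOver G (monomialColon (symbolicMonomials G (s + 1)) m) from this.1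
  induction s generalizing m with
  | zero =>
    obtain rfl := isEdgeProduct_zero.1 hm
    have hone : monomialColon (symbolicMonomials G 1) 0 = edgeMonomials G.Adj := by
      simp [monomialColon, symbolicMonomials_one]
    rw [hone]
    exact ⟨h, .inr ⟨G.Adj, fun _ _ h => h.symm, fun _ _ h => h, rfl⟩⟩
  | succ s ih =>
    obtain ⟨m, u, v, hm', huv, rfl⟩ := isEdgeProduct_succ.1 hm
    obtain ⟨hreg, hquad⟩ := ih hm'
    rw [monomialColon_symbolicMonomials_add_edge hm' huv]
    exact ⟨hreg.inter_monomialColon_of_isQuadraticOver hr hquad huv,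
      hquad.inter_monomialColon_single u v⟩

/-- Adjoin the products of `s` edges to the symbolic power one at a time. -/
theorem RegularityLE.symbolicMonomials_of_union [Nontrivial R]
    (h : RegularityLE R (edgeMonomials G.Adj) r)
    (hunion : RegularityLE R (symbolicMonomials G (s + 1) ∪ powerMonomials G s) (r + (2 * s : ℕ))) :
    RegularityLE R (symbolicMonomials G (s + 1)) (r + (2 * s : ℕ)) := by
  rcases s.eq_zero_or_pos with rfl | hs
  · simpa [symbolicMonomials_one] using h
  have hfin : {m : Lex (V →₀ ℕ) | IsEdgeProduct G s (ofLex m)}.Finite :=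
    (Set.Finite.preimage (s := {m | IsEdgeProduct G s m}) ofLex.injective.injOn
      (finite_setOf_isEdgeProduct s) :)
  have hup := isUpperSet_symbolicMonomials (G := G) (s + 1)
  refine .of_colons_of_union (f := ofLex) hup hfin.toFinset (fun m hm => ?_) (fun m hm => ?_) ?_
  · exact (hfin.mem_toFinset.1 hm).degree_eq
  · have hm := hfin.mem_toFinset.1 hm
    obtain ⟨u, v, huv, -⟩ := id hm
    have hr : 2 ≤ r := h.two_le_of_edge (huv ⟨0, hs⟩) (G.irrefl) (G.irrefl)
    simp only [Set.Finite.mem_toFinset, Set.mem_ofPred_eq]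
    change RegularityLE R (monomialColon (_ ∪ laterMonomials G s m) _) r
    rw [monomialColon_union_laterMonomials hm]
    refine RegularityLEOff.union_variableMonomials (by omega) (isUpperSet_monomialColon hup _) ?_
    exact fun a _ => h.monomialColon_symbolicMonomials (by omega) hm a
  · simp only [Set.Finite.mem_toFinset, Set.mem_ofPred_eq]
    exact hunion

end SymbolicColon

section OddCycles

/-! ### Odd cycles, vertex covers and matchings -/

variable {W : Type*} {H : SimpleGraph W} {v : W} {w : H.Walk v v} {i j n : ℕ}

lemma exists_walk_getVert {u : W} (p : H.Walk u v) (hij : i ≤ j) (hj : j ≤ p.length) :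
    ∃ q : H.Walk (p.getVert i) (p.getVert j), q.length = j - i := by
  induction j, hij using Nat.le_induction with
  | base => exact ⟨.nil, by simp⟩
  | succ j hij ih =>
    obtain ⟨q, hq⟩ := ih (by omega)
    exact ⟨q.concat (p.adj_getVert_succ (by omega)), by rw [SimpleGraph.Walk.length_concat]; omega⟩

lemma exists_walk_getVert_compl (w : H.Walk v v) (hij : i ≤ j) (hj : j ≤ w.length) :
    ∃ q : H.Walk (w.getVert j) (w.getVert i), q.length = w.length - (j - i) := by
  obtain ⟨q, hq⟩ := exists_walk_getVert w hj le_rfl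
  obtain ⟨q', hq'⟩ := exists_walk_getVert w (Nat.zero_le i) (hij.trans hj)
  refine ⟨(q.copy rfl (by simp)).append q', ?_⟩
  rw [SimpleGraph.Walk.length_append, SimpleGraph.Walk.length_copy]
  omega

/-- A closed walk of odd length, as short as any other. Such a walk is an induced cycle. -/
def IsShortestOddWalk (w : H.Walk v v) : Prop :=
  Odd w.length ∧ ∀ (u : W) (w' : H.Walk u u), Odd w'.length → w.length ≤ w'.length

lemma exists_isShortestOddWalk (hw : Odd w.length) :
    ∃ (u : W) (w' : H.Walk u u), IsShortestOddWalk w' ∧ w'.length ≤ w.length := by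
  classical
  have hex : ∃ n, ∃ (u : W) (w' : H.Walk u u), Odd w'.length ∧ w'.length = n :=
    ⟨_, v, w, hw, rfl⟩
  obtain ⟨u, w', hodd, hlen⟩ := Nat.find_spec hex
  exact ⟨u, w', ⟨hodd, fun x w'' h => hlen ▸ Nat.find_min' hex ⟨x, w'', h, rfl⟩⟩,
    hlen ▸ Nat.find_min' hex ⟨v, w, hw, rfl⟩⟩

namespace IsShortestOddWalk

lemma three_le (hw : IsShortestOddWalk w) : 3 ≤ w.length := by
  obtain ⟨k, hk⟩ := hw.1
  by_contra hlt
  have hone : w.length = 1 := by omega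
  have hadj := w.adj_getVert_succ (i := 0) (by omega)
  rw [zero_add, ← hone, SimpleGraph.Walk.getVert_length, SimpleGraph.Walk.getVert_zero] at hadj
  exact H.irrefl hadj

lemma getVert_ne (hw : IsShortestOddWalk w) (hij : i < j) (hj : j < w.length) :
    w.getVert i ≠ w.getVert j := by
  intro he
  obtain ⟨q, hq⟩ := exists_walk_getVert w hij.le hj.le
  obtain ⟨q', hq'⟩ := exists_walk_getVert_compl w hij.le hj.le
  rcases Nat.even_or_odd (j - i) with h | h
  · have := hw.2 _ (q'.copy rfl he) (by
      rw [SimpleGraph.Walk.length_copy, hq']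
      exact Nat.Odd.sub_even (by omega) hw.1 h)
    rw [SimpleGraph.Walk.length_copy] at this
    omega
  · have := hw.2 _ (q.copy rfl he.symm) (by rwa [SimpleGraph.Walk.length_copy, hq])
    rw [SimpleGraph.Walk.length_copy] at this
    omega

lemma adj_getVert_iff (hw : IsShortestOddWalk w) (hij : i < j) (hj : j < w.length) :
    H.Adj (w.getVert i) (w.getVert j) ↔ j = i + 1 ∨ i = 0 ∧ j + 1 = w.length := by
  constructor
  · intro hadj
    obtain ⟨q, hq⟩ := exists_walk_getVert w hij.le hj.le
    obtain ⟨q', hq'⟩ := exists_walk_getVert_compl w hij.le hj.le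
    rcases Nat.even_or_odd (j - i) with h | h
    · have := hw.2 _ (.cons hadj.symm q) (by
        rw [SimpleGraph.Walk.length_cons, hq]
        exact h.add_one)
      rw [SimpleGraph.Walk.length_cons] at this
      omega
    · have := hw.2 _ (.cons hadj q') (by
        rw [SimpleGraph.Walk.length_cons, hq']
        exact (Nat.Odd.sub_odd hw.1 h).add_one)
      rw [SimpleGraph.Walk.length_cons] at this
      omega
  · rintro (rfl | ⟨rfl, hlen⟩)
    · exact w.adj_getVert_succ (by omega)
    · have hadj := w.adj_getVert_succ hj
      rw [hlen, SimpleGraph.Walk.getVert_length] at hadj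
      simpa using hadj.symm

end IsShortestOddWalk

lemma cycleGraph_adj_of_lt {i j : Fin n} (hij : i < j) :
    (SimpleGraph.cycleGraph n).Adj i j ↔ j.val = i.val + 1 ∨ i.val = 0 ∧ j.val + 1 = n := by
  rw [SimpleGraph.cycleGraph_adj', Fin.val_sub, Fin.val_sub, Nat.mod_eq_of_lt (by omega),
    show n - i.val + j.val = j.val - i.val + n by omega, Nat.add_mod_right,
    Nat.mod_eq_of_lt (by omega)]
  omega

lemma IsShortestOddWalk.nonempty_embedding_cycleGraph (hw : IsShortestOddWalk w) :
    Nonempty (SimpleGraph.cycleGraph w.length ↪g H) := by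
  refine ⟨⟨⟨fun i => w.getVert i, fun i j h => ?_⟩, fun {i j} => ?_⟩⟩
  · rcases lt_trichotomy i j with hij | hij | hij
    · exact absurd h (hw.getVert_ne hij j.2)
    · exact hij
    · exact absurd h.symm (hw.getVert_ne hij i.2)
  · change H.Adj (w.getVert i) (w.getVert j) ↔ _
    rcases lt_trichotomy i j with hij | rfl | hij
    · rw [hw.adj_getVert_iff hij j.2, cycleGraph_adj_of_lt hij]
    · simp
    · rw [H.adj_comm, (SimpleGraph.cycleGraph _).adj_comm, hw.adj_getVert_iff hij i.2,
        cycleGraph_adj_of_lt hij]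

lemma exists_embedding_cycleGraph_of_odd (hw : Odd w.length) :
    ∃ n, 1 ≤ n ∧ 2 * n + 1 ≤ w.length ∧ Nonempty (SimpleGraph.cycleGraph (2 * n + 1) ↪g H) := by
  obtain ⟨u, w', hw', hle⟩ := exists_isShortestOddWalk hw
  obtain ⟨n, hn⟩ := hw'.1
  have := hw'.three_le
  exact ⟨n, by omega, hn ▸ hle, hn ▸ hw'.nonempty_embedding_cycleGraph⟩

lemma exists_isCycle_odd_length_le (hw : Odd w.length) :
    ∃ (u : W) (c : H.Walk u u), c.IsCycle ∧ Odd c.length ∧ c.length ≤ w.length := by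
  obtain ⟨n, hn, hle, ⟨f⟩⟩ := exists_embedding_cycleGraph_of_odd hw
  obtain ⟨u, c, hc, hlen⟩ :=
    (SimpleGraph.cycleGraph_isContained_iff (by omega)).1 f.isContained
  exact ⟨u, c, hc, ⟨n, hlen⟩, hlen.trans_le hle⟩

end OddCycles

section Matchings

variable {W W' ι κ : Type*} {H : SimpleGraph W} {H' : SimpleGraph W'} {p q : ι → W} {s : ℕ}

/-- The edges `p i q i` form a matching: they are pairwise disjoint. -/
def IsMatchingFamily (H : SimpleGraph W) (p q : ι → W) : Prop :=
  (∀ i, H.Adj (p i) (q i)) ∧ Function.Injective (Sum.elim p q)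

namespace IsMatchingFamily

lemma comp_embedding (h : IsMatchingFamily H p q) (e : κ ↪ ι) :
    IsMatchingFamily H (p ∘ e) (q ∘ e) := by
  refine ⟨fun i => h.1 _, ?_⟩
  rw [← Sum.elim_comp_map]
  exact h.2.comp (Sum.map_injective.2 ⟨e.injective, e.injective⟩)

lemma map (h : IsMatchingFamily H p q) (f : H ↪g H') : IsMatchingFamily H' (f ∘ p) (f ∘ q) := by
  refine ⟨fun i => f.map_adj_iff.2 (h.1 i), ?_⟩
  rw [← Sum.comp_elim]
  exact f.injective.comp h.2

lemma option_elim (h : IsMatchingFamily H p q) {x y : W} (hxy : H.Adj x y)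
    (hx : ∀ i, Sum.elim p q i ≠ x) (hy : ∀ i, Sum.elim p q i ≠ y) :
    IsMatchingFamily H (fun i : Option ι => i.elim x p) (fun i => i.elim y q) := by
  refine ⟨Option.rec hxy h.1, ?_⟩
  have hp : Function.Injective p := h.2.comp Sum.inl_injective
  have hq : Function.Injective q := h.2.comp Sum.inr_injective
  have hpq (i j : ι) : p i ≠ q j := h.2.ne (a₁ := .inl i) (a₂ := .inr j) Sum.inl_ne_inr
  refine Function.Injective.sumElim ?_ ?_ ?_
  · exact Option.injective_iff.2 ⟨hp, fun ⟨i, hi⟩ => hx (.inl i) hi⟩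
  · exact Option.injective_iff.2 ⟨hq, fun ⟨i, hi⟩ => hy (.inr i) hi⟩
  · rintro (_ | i) (_ | j)
    exacts [hxy.ne, (hx (.inr j)).symm, hy (.inl i), hpq i j]

lemma exists_fin [Fintype ι] (h : IsMatchingFamily H p q) (hs : s ≤ Fintype.card ι) :
    ∃ p' q' : Fin s → W, IsMatchingFamily H p' q' := by
  obtain ⟨e⟩ := Function.Embedding.nonempty_of_card_le ((Fintype.card_fin s).trans_le hs)
  exact ⟨_, _, h.comp_embedding e⟩

end IsMatchingFamily

/-- Exchanging an independent set of vertices of a minimum cover for its neighbours outside the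
cover gives a cover again. -/
lemma card_le_card_neighbors_of_minimum_cover [Fintype W] [DecidableEq W] [DecidableRel H.Adj]
    {S T : Finset W} (hT : H.IsVertexCover T)
    (hmin : ∀ T' : Finset W, H.IsVertexCover T' → T.card ≤ T'.card) (hST : S ⊆ T)
    (hS : H.IsIndepSet S) : S.card ≤ (S.biUnion fun x => {y | y ∉ T ∧ H.Adj x y}).card := by
  set N : Finset W := S.biUnion fun x => {y | y ∉ T ∧ H.Adj x y} with hN
  have hcov {x y : W} (hxy : H.Adj x y) (hx : x ∈ T) : x ∈ T \ S ∪ N ∨ y ∈ T \ S ∪ N := by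
    have hy (hxS : x ∈ S) : y ∉ S := fun hyS => hS hxS hyS hxy.ne hxy
    simp only [hN, Finset.mem_union, Finset.mem_sdiff, Finset.mem_biUnion, Finset.mem_filter_univ]
    by_cases hxS : x ∈ S
    · by_cases hyT : y ∈ T
      · exact .inr (.inl ⟨hyT, hy hxS⟩)
      · exact .inr (.inr ⟨x, hxS, hyT, hxy⟩)
    · exact .inl (.inl ⟨hx, hxS⟩)
  have hle : T.card ≤ (T \ S ∪ N).card := hmin _ fun x y hxy =>
    (hT hxy).elim (hcov hxy) fun hy => (hcov hxy.symm hy).symm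
  have := Finset.card_union_le (T \ S) N
  have := Finset.card_sdiff_add_card_eq_card hST
  omega

/-- **König's theorem**, by Hall's marriage theorem applied to a minimum cover: its vertices of
either colour are independent, and their neighbours have the other colour. -/
theorem exists_isMatchingFamily_of_minimum_cover [Finite W] (col : H.Coloring Bool) {T : Finset W}
    (hT : H.IsVertexCover T) (hmin : ∀ T' : Finset W, H.IsVertexCover T' → T.card ≤ T'.card) :
    ∃ q : T → W, IsMatchingFamily H Subtype.val q := by
  classical
  cases nonempty_fintype W
  let N (x : T) : Finset W := {y | y ∉ T ∧ H.Adj x y}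
  have hmono (S : Finset T) (b : Bool) : (S.filter (col ·.1 = b)).card ≤
      ((S.biUnion N).filter (col · ≠ b)).card := by
    have hle := card_le_card_neighbors_of_minimum_cover hT hmin
      (S := (S.filter (col ·.1 = b)).map (.subtype _)) (Finset.map_subtype_subset _) ?_
    · rw [Finset.card_map] at hle
      refine hle.trans (Finset.card_le_card fun y hy => ?_)
      simp only [Finset.mem_biUnion, Finset.mem_map, Finset.mem_filter] at hy ⊢
      obtain ⟨_, ⟨x, ⟨hx, hxb⟩, rfl⟩, hy⟩ := hy
      exact ⟨⟨x, hx, by simpa [N] using hy⟩, fun hyb => col.valid hy.2.2 (hxb.trans hyb.symm)⟩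
    · intro x hx y hy _ hxy
      simp only [Finset.mem_coe, Finset.mem_map, Finset.mem_filter] at hx hy
      obtain ⟨x, ⟨-, hx⟩, rfl⟩ := hx
      obtain ⟨y, ⟨-, hy⟩, rfl⟩ := hy
      exact col.valid hxy (hx.trans hy.symm)
  obtain ⟨q, hq, hqN⟩ := (Finset.all_card_le_biUnion_card_iff_exists_injective N).1 fun S => by
    rw [← S.card_filter_add_card_filter_not (col ·.1 = true),
      ← (S.biUnion N).card_filter_add_card_filter_not (col · = true), add_comm]
    simpa using add_le_add (hmono S false) (hmono S true)
  simp only [N, Finset.mem_filter_univ] at hqN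
  exact ⟨q, fun i => (hqN i).2, Subtype.val_injective.sumElim hq fun i j h => (hqN j).1 (h ▸ i.2)⟩

lemma exists_isMatchingFamily_cycleGraph (n : ℕ) (c : Fin (2 * n + 1)) :
    ∃ p q : Fin n → Fin (2 * n + 1), IsMatchingFamily (SimpleGraph.cycleGraph (2 * n + 1)) p q ∧
      ∀ i, Sum.elim p q i ≠ c := by
  let t : Fin n ⊕ Fin n → Fin (2 * n + 1) :=
    Sum.elim (fun i => ⟨2 * i + 1, by omega⟩) fun i => ⟨2 * i + 2, by omega⟩
  have ht : Function.Injective t := by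
    rintro (i | i) (j | j) h <;> simp only [t, Sum.elim_inl, Sum.elim_inr, Fin.mk.injEq] at h
    all_goals simp; omega
  have ht0 (i) : t i ≠ 0 := by rcases i with i | i <;> simp [t, Fin.ext_iff]
  refine ⟨fun i => c + t (.inl i), fun i => c + t (.inr i), ⟨fun i => ?_, ?_⟩, ?_⟩
  · rw [SimpleGraph.cycleGraph_adj', add_sub_add_left_eq_sub, add_sub_add_left_eq_sub]
    refine .inr ?_
    rw [Fin.sub_val_of_le] <;> simp [t, Fin.le_def]
  · convert (add_right_injective c).comp ht using 1
    ext (i | i) <;> rfl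
  · rintro (i | i) <;> simpa using ht0 _

lemma exists_isVertexCover_cycleGraph (n : ℕ) : ∃ C : Finset (Fin (2 * n + 1)),
    (SimpleGraph.cycleGraph (2 * n + 1)).IsVertexCover C ∧ C.card ≤ n + 1 := by
  let double (l : Fin (n + 1)) : Fin (2 * n + 1) := ⟨2 * l, by omega⟩
  have hmem {i : Fin (2 * n + 1)} (hi : i.val % 2 = 0) : i ∈ Finset.univ.image double :=
    Finset.mem_image.2 ⟨⟨i / 2, by omega⟩, Finset.mem_univ _, Fin.ext (by simp [double]; omega)⟩
  refine ⟨Finset.univ.image double, fun i j hij => ?_, Finset.card_image_le.trans (by simp)⟩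
  wlog hlt : i < j generalizing i j
  · exact (this _ _ hij.symm (hij.ne.lt_or_gt.resolve_left hlt)).symm
  rw [cycleGraph_adj_of_lt hlt] at hij
  rcases Nat.mod_two_eq_zero_or_one i with hi | hi
  · exact .inl (hmem hi)
  · exact .inr (hmem (by omega))

lemma exists_isMatchingFamily_option_of_embedding {n : ℕ}
    (f : SimpleGraph.cycleGraph (2 * n + 1) ↪g H)
    (hcov : ∀ T : Finset W, H.IsVertexCover T → n + 2 ≤ T.card) :
    ∃ p q : Option (Fin n) → W, IsMatchingFamily H p q := by
  have hexit {x y : W} (hxy : H.Adj x y) (hy : y ∉ Set.range f) :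
      ∃ p q : Option (Fin n) → W, IsMatchingFamily H p q := by
    obtain ⟨c, hc⟩ : ∃ c, ∀ i, f i = x → i = c := by
      by_cases hx : x ∈ Set.range f
      · obtain ⟨c, rfl⟩ := hx
        exact ⟨c, fun i h => f.injective h⟩
      · exact ⟨0, fun i h => absurd ⟨i, h⟩ hx⟩
    obtain ⟨p, q, hpq, hne⟩ := exists_isMatchingFamily_cycleGraph n c
    refine ⟨_, _, (hpq.map f).option_elim hxy ?_ ?_⟩ <;> rw [← Sum.comp_elim]
    · exact fun i h => hne i (hc _ h)
    · exact fun i h => hy ⟨_, h⟩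
  obtain ⟨C, hC, hcard⟩ := exists_isVertexCover_cycleGraph n
  have hnot : ¬ H.IsVertexCover (C.map f.toEmbedding : Finset W) := fun h => by
    have := hcov _ h
    rw [Finset.card_map] at this
    omega
  simp only [SimpleGraph.IsVertexCover, not_forall, not_or] at hnot
  obtain ⟨x, y, hxy, hx, hy⟩ := hnot
  by_cases hyf : y ∈ Set.range f
  · refine hexit hxy.symm fun hxf => ?_
    obtain ⟨i, rfl⟩ := hxf
    obtain ⟨j, rfl⟩ := hyf
    exact (hC (f.map_adj_iff.1 hxy)).elim (fun h => hx (Finset.mem_map_of_mem _ h))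
      fun h => hy (Finset.mem_map_of_mem _ h)
  · exact hexit hxy hyf

/-- If the shortest odd cycle of `H` is too short to contain `s` disjoint edges, then every other
vertex of it is too few to cover `H`; an edge missed by these leaves the cycle, and is disjoint
from a matching of the cycle with `s - 1` edges. -/
theorem exists_isMatchingFamily_of_odd_walks [Finite W]
    (hodd : ∀ (v : W) (w : H.Walk v v), Odd w.length → 2 * s ≤ w.length + 1)
    (hcov : ∀ T : Finset W, H.IsVertexCover T → s + 1 ≤ T.card) :
    ∃ p q : Fin s → W, IsMatchingFamily H p q := by
  classical
  cases nonempty_fintype W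
  by_cases hbip : H.Colorable 2
  · obtain ⟨T, hT, hmin⟩ := Finset.exists_min_image
      {T : Finset W | H.IsVertexCover T} Finset.card ⟨Finset.univ, by simp⟩
    simp only [Finset.mem_filter_univ] at hT hmin
    obtain ⟨q, hq⟩ := exists_isMatchingFamily_of_minimum_cover (hbip.toColoring (by simp)) hT hmin
    exact hq.exists_fin (by simpa using (Nat.le_succ s).trans (hcov T hT))
  · simp only [SimpleGraph.two_colorable_iff_forall_loop_even, not_forall,
      Nat.not_even_iff_odd] at hbip
    obtain ⟨v, w, hw⟩ := hbip
    obtain ⟨n, hn, -, ⟨f⟩⟩ := exists_embedding_cycleGraph_of_odd hw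
    obtain ⟨v, c, -, hlen⟩ := (SimpleGraph.cycleGraph_isContained_iff (by omega)).1 f.isContained
    have hsn : s ≤ n + 1 := by
      have := hodd v c ⟨n, hlen⟩
      omega
    obtain rfl | hsn := hsn.eq_or_lt
    · obtain ⟨p, q, hpq⟩ := exists_isMatchingFamily_option_of_embedding f hcov
      exact hpq.exists_fin (by simp)
    · obtain ⟨p, q, hpq, -⟩ := exists_isMatchingFamily_cycleGraph n 0
      exact (hpq.map f).exists_fin (by simpa using Nat.lt_succ_iff.1 hsn)

end Matchings

section SymbolicInPower

variable {V : Type*} {G : SimpleGraph V} {a : V →₀ ℕ} {s t : ℕ}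

/-- The graph obtained from `G` by replacing each vertex `x` by `a x` independent copies. -/
def blowUp (G : SimpleGraph V) (a : V →₀ ℕ) : SimpleGraph (Σ x, Fin (a x)) := G.comap Sigma.fst

lemma exists_isCycle_odd_length_le_of_blowUp {v : Σ x, Fin (a x)} {w : (blowUp G a).Walk v v}
    (hw : Odd w.length) :
    ∃ (u : V) (c : G.Walk u u), c.IsCycle ∧ Odd c.length ∧ c.length ≤ w.length := by
  let φ : blowUp G a →g G := ⟨Sigma.fst, id⟩
  rw [← w.length_map φ] at hw ⊢
  exact exists_isCycle_odd_length_le hw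

variable [Finite V]

lemma le_card_of_isVertexCover_blowUp (ha : a ∈ symbolicMonomials G t)
    {T : Finset (Σ x, Fin (a x))} (hT : (blowUp G a).IsVertexCover T) : t ≤ T.card := by
  classical
  cases nonempty_fintype V
  let C : Finset V := {x | ∀ i : Fin (a x), ⟨x, i⟩ ∈ T}
  have hC : G.IsVertexCover C := by
    intro x y hxy
    by_contra! hcon
    simp only [C, Finset.coe_filter_univ, Set.mem_ofPred_eq, not_forall] at hcon
    obtain ⟨⟨i, hi⟩, j, hj⟩ := hcon
    exact (hT (show (blowUp G a).Adj ⟨x, i⟩ ⟨y, j⟩ from hxy)).elim hi hj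
  have hsub : C.sigma (fun x => (Finset.univ : Finset (Fin (a x)))) ⊆ T := by
    rintro ⟨x, i⟩ hx
    exact Finset.mem_filter_univ x |>.1 (Finset.mem_sigma.1 hx).1 i
  calc t ≤ ∑ x ∈ C, a x := ha C hC
    _ = (C.sigma fun x => (Finset.univ : Finset (Fin (a x)))).card := by simp
    _ ≤ T.card := Finset.card_le_card hsub

lemma prodVec_fst_le {ι : Type*} [Fintype ι] {d : ι → Σ x, Fin (a x)}
    (hd : Function.Injective d) : prodVec (Sigma.fst ∘ d) ≤ a := by
  classical
  cases nonempty_fintype V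
  calc prodVec (Sigma.fst ∘ d) = ∑ z ∈ Finset.univ.map ⟨d, hd⟩, single z.1 1 := by
        rw [Finset.sum_map]; rfl
    _ ≤ ∑ z : Σ x, Fin (a x), single z.1 1 := Finset.sum_le_sum_of_subset (Finset.subset_univ _)
    _ = a := by
        rw [Fintype.sum_sigma]
        simp

theorem symbolicMonomials_subset_powerMonomials
    (hG : ∀ (v : V) (c : G.Walk v v), c.IsCycle → Odd c.length → 2 * s ≤ c.length + 1) :
    symbolicMonomials G (s + 1) ⊆ powerMonomials G s := by
  intro a ha
  have hodd (v) (w : (blowUp G a).Walk v v) (hw : Odd w.length) : 2 * s ≤ w.length + 1 := by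
    obtain ⟨u, c, hc, hodd, hle⟩ := exists_isCycle_odd_length_le_of_blowUp hw
    exact (hG u c hc hodd).trans (Nat.add_le_add_right hle 1)
  obtain ⟨p, q, hadj, hinj⟩ := exists_isMatchingFamily_of_odd_walks hodd
    fun T hT => le_card_of_isVertexCover_blowUp ha hT
  refine ⟨prodVec (Sigma.fst ∘ p) + prodVec (Sigma.fst ∘ q),
    ⟨Sigma.fst ∘ p, Sigma.fst ∘ q, hadj, rfl⟩, ?_⟩
  have hsum : prodVec (Sigma.fst ∘ Sum.elim p q) =
      prodVec (Sigma.fst ∘ p) + prodVec (Sigma.fst ∘ q) := Fintype.sum_sum_type _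
  exact hsum ▸ prodVec_fst_le hinj

end SymbolicInPower

section HomogeneousVectors

/-! ### Graded free modules -/

variable {V K ι κ : Type*} [Field K] {deg : ι → ℤ} {deg' : κ → ℤ} {i j : ℤ}
  {f : ι → MvPolynomial V K}

variable (V K) in
/-- The homogeneous elements of degree `j` of the graded free module `⨁ b, S(-deg b)`, as a vector
space over `K`. -/
def homogeneousVectors (deg : ι → ℤ) (j : ℤ) : Submodule K (ι → MvPolynomial V K) :=
  Submodule.pi Set.univ fun b => restrictSupport K {m | (m.degree : ℤ) + deg b = j}

lemma mem_homogeneousVectors :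
    f ∈ homogeneousVectors V K deg j ↔ IsHomogeneousVector deg f j := by
  simp only [homogeneousVectors, Submodule.mem_pi, Set.mem_univ, true_imp_iff,
    mem_restrictSupport_iff]
  rfl

lemma isHomogeneousVector_zero : IsHomogeneousVector deg (0 : ι → MvPolynomial V K) j :=
  mem_homogeneousVectors.1 (zero_mem _)

lemma isHomogeneousVector_single_monomial [DecidableEq ι] (b : ι) (m : V →₀ ℕ) (r : K) :
    IsHomogeneousVector deg (Pi.single b (monomial m r)) (m.degree + deg b) := by
  intro c n hn
  obtain rfl : c = b := by
    by_contra hcb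
    rw [Pi.single_eq_of_ne hcb] at hn
    simp at hn
  rw [Pi.single_eq_same] at hn
  rw [Finset.mem_singleton.1 (support_monomial_subset hn)]

lemma IsHomogeneousVector.monomial_smul (hf : IsHomogeneousVector deg f j) (m : V →₀ ℕ) (r : K) :
    IsHomogeneousVector deg (monomial m r • f) (m.degree + j) := by
  intro b n hn
  rw [Pi.smul_apply, smul_eq_mul, mem_support_iff, coeff_monomial_mul', ite_ne_right_iff] at hn
  obtain ⟨hmn, hne⟩ := hn
  obtain ⟨n, rfl⟩ := exists_add_of_le hmn
  rw [add_tsub_cancel_left] at hne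
  rw [map_add, Nat.cast_add, add_assoc, hf b n (mem_support_iff.2 (right_ne_zero_of_mul hne))]

lemma IsHomogeneousVector.X_smul (hf : IsHomogeneousVector deg f j) (x : V) :
    IsHomogeneousVector deg ((X x : MvPolynomial V K) • f) (j + 1) := by
  simpa [X, add_comm] using hf.monomial_smul (single x 1) 1

/-- The projection of the graded free module `⨁ b, S(-deg b)` onto its homogeneous component of
degree `j`. -/
def homogeneousPart (deg : ι → ℤ) (j : ℤ) :
    (ι → MvPolynomial V K) →ₗ[K] (ι → MvPolynomial V K) :=
  LinearMap.pi fun b =>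
    (if deg b ≤ j then homogeneousComponent (j - deg b).toNat else 0) ∘ₗ LinearMap.proj b

lemma coeff_homogeneousPart (f : ι → MvPolynomial V K) (b : ι) (m : V →₀ ℕ) :
    coeff m (homogeneousPart deg j f b) =
      if (m.degree : ℤ) + deg b = j then coeff m (f b) else 0 := by
  rw [homogeneousPart, LinearMap.pi_apply, LinearMap.comp_apply, LinearMap.proj_apply]
  by_cases hb : deg b ≤ j
  · rw [if_pos hb, coeff_homogeneousComponent]
    exact if_congr (by omega) rfl rfl
  · rw [if_neg hb, LinearMap.zero_apply, coeff_zero, if_neg (by omega)]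

lemma isHomogeneousVector_homogeneousPart (f : ι → MvPolynomial V K) :
    IsHomogeneousVector deg (homogeneousPart deg j f) j := by
  intro b m hm
  rw [mem_support_iff, coeff_homogeneousPart] at hm
  exact (ite_ne_right_iff.1 hm).1

lemma IsHomogeneousVector.homogeneousPart_eq (hf : IsHomogeneousVector deg f j) :
    homogeneousPart deg j f = f := by
  ext b m
  rw [coeff_homogeneousPart, ite_eq_left_iff]
  exact fun h => (notMem_support_iff.1 fun hm => h (hf b m hm)).symm

lemma IsHomogeneousVector.homogeneousPart_of_ne (hf : IsHomogeneousVector deg f i) (hij : i ≠ j) :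
    homogeneousPart deg j f = 0 := by
  ext b m
  rw [coeff_homogeneousPart, Pi.zero_apply, coeff_zero, ite_eq_right_iff]
  exact fun h => notMem_support_iff.1 fun hm => hij ((hf b m hm).symm.trans h)

/-- The linear map `φ` of graded free modules preserves the degrees. -/
def IsHomogeneousMap [DecidableEq ι] (deg : ι → ℤ) (deg' : κ → ℤ)
    (φ : (ι → MvPolynomial V K) →ₗ[MvPolynomial V K] (κ → MvPolynomial V K)) : Prop :=
  ∀ b, IsHomogeneousVector deg' (φ (Pi.single b 1)) (deg b)

variable [DecidableEq ι] {φ : (ι → MvPolynomial V K) →ₗ[MvPolynomial V K] (κ → MvPolynomial V K)}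

lemma single_eq_smul_single_one (b : ι) (g : MvPolynomial V K) :
    (Pi.single b g : ι → MvPolynomial V K) = g • Pi.single b 1 := by
  rw [← Pi.single_smul, smul_eq_mul, mul_one]

lemma IsHomogeneousMap.map_homogeneousPart [Finite ι] (hφ : IsHomogeneousMap deg deg' φ)
    (f : ι → MvPolynomial V K) :
    φ (homogeneousPart deg j f) = homogeneousPart deg' j (φ f) := by
  suffices h : φ.restrictScalars K ∘ₗ homogeneousPart deg j =
      homogeneousPart deg' j ∘ₗ φ.restrictScalars K from LinearMap.congr_fun h f
  refine LinearMap.pi_ext' fun b => linearMap_ext fun m => LinearMap.ext fun r => ?_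
  change φ (homogeneousPart deg j (Pi.single b (monomial m r))) =
    homogeneousPart deg' j (φ (Pi.single b (monomial m r)))
  have hsource := isHomogeneousVector_single_monomial (deg := deg) b m r
  have htarget : IsHomogeneousVector deg' (φ (Pi.single b (monomial m r))) (m.degree + deg b) := by
    rw [single_eq_smul_single_one, map_smul]
    exact (hφ b).monomial_smul m r
  by_cases h : (m.degree : ℤ) + deg b = j
  · rw [h] at hsource htarget
    rw [hsource.homogeneousPart_eq, htarget.homogeneousPart_eq]
  · rw [hsource.homogeneousPart_of_ne h, htarget.homogeneousPart_of_ne h, map_zero]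

end HomogeneousVectors

section KoszulHomology

/-! ### Koszul homology of graded modules -/

variable {V K ι : Type*} [Field K]

/-- `c` is a homogeneous Koszul chain of the graded submodule `M` of `⨁ b, S(-deg b)`, of
homological degree `p` and internal degree `j`. -/
structure IsKoszulChain (deg : ι → ℤ) (M : Submodule (MvPolynomial V K) (ι → MvPolynomial V K))
    (p : ℕ) (j : ℤ) (c : Finset V → ι → MvPolynomial V K) : Prop where
  mem : ∀ τ, c τ ∈ M
  card : ∀ τ, c τ ≠ 0 → τ.card = p
  isHomogeneous : ∀ τ, IsHomogeneousVector deg (c τ) (j - p)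

variable {deg : ι → ℤ} {M M' : Submodule (MvPolynomial V K) (ι → MvPolynomial V K)} {p : ℕ} {j : ℤ}
  {c c' : Finset V → ι → MvPolynomial V K}

lemma IsKoszulChain.of_mem (hc : IsKoszulChain deg M p j c) (h : ∀ τ, c τ ∈ M') :
    IsKoszulChain deg M' p j c := ⟨h, hc.card, hc.isHomogeneous⟩

lemma IsKoszulChain.sub (hc : IsKoszulChain deg M p j c) (hc' : IsKoszulChain deg M p j c') :
    IsKoszulChain deg M p j (c - c') where
  mem τ := sub_mem (hc.mem τ) (hc'.mem τ)
  card τ h := by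
    by_cases hτ : c τ = 0
    · exact hc'.card τ fun hτ' => h (by rw [Pi.sub_apply, hτ, hτ', sub_zero])
    · exact hc.card τ hτ
  isHomogeneous τ := mem_homogeneousVectors.1 <|
    sub_mem (mem_homogeneousVectors.2 (hc.isHomogeneous τ))
      (mem_homogeneousVectors.2 (hc'.isHomogeneous τ))

lemma IsHomogeneousVector.isKoszulChain_single [DecidableEq V] {f : ι → MvPolynomial V K}
    (hf : IsHomogeneousVector deg f j) (hM : f ∈ M) :
    IsKoszulChain deg M 0 j (Pi.single ∅ f) where
  mem τ := by
    rcases eq_or_ne τ ∅ with rfl | hτ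
    · rwa [Pi.single_eq_same]
    · rw [Pi.single_eq_of_ne hτ]
      exact zero_mem M
  card τ h := by
    by_contra hτ
    exact h (by rw [Pi.single_eq_of_ne (mt Finset.card_eq_zero.2 hτ)])
  isHomogeneous τ := by
    rw [Nat.cast_zero, sub_zero]
    rcases eq_or_ne τ ∅ with rfl | hτ
    · rwa [Pi.single_eq_same]
    · rw [Pi.single_eq_of_ne hτ]
      exact isHomogeneousVector_zero

variable [LinearOrder V] [Fintype V]

variable (K) in
/-- The Koszul differential with respect to the variables. -/
abbrev variableDifferential {N : Type*} [AddCommGroup N] [Module (MvPolynomial V K) N] :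
    (Finset V → N) →ₗ[MvPolynomial V K] (Finset V → N) :=
  koszulDifferential fun v => (X v : MvPolynomial V K)

/-- The Koszul homology of `M` vanishes in homological degree `p` and internal degree `j`. -/
def KoszulExactAt (deg : ι → ℤ) (M : Submodule (MvPolynomial V K) (ι → MvPolynomial V K))
    (p : ℕ) (j : ℤ) : Prop :=
  ∀ c, IsKoszulChain deg M p j c → variableDifferential K c = 0 →
    ∃ c', IsKoszulChain deg M (p + 1) j c' ∧ variableDifferential K c' = c

lemma IsKoszulChain.differential (hc : IsKoszulChain deg M (p + 1) j c) :
    IsKoszulChain deg M p j (variableDifferential K c) where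
  mem τ := M.sum_mem fun x _ => zsmul_mem (M.smul_mem _ (hc.mem _)) _
  card τ h := by
    obtain ⟨x, hx, hne⟩ := Finset.exists_ne_zero_of_sum_ne_zero h
    have hcard := hc.card (insert x τ) (right_ne_zero_of_smul (right_ne_zero_of_smul hne))
    rw [Finset.card_insert_of_notMem (Finset.mem_compl.1 hx)] at hcard
    exact Nat.succ_injective hcard
  isHomogeneous τ := by
    refine mem_homogeneousVectors.1 (sum_mem fun x _ => zsmul_mem (mem_homogeneousVectors.2 ?_) _)
    convert (hc.isHomogeneous (insert x τ)).X_smul x using 1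
    push_cast
    ring

lemma IsKoszulChain.differential_eq_zero (hc : IsKoszulChain deg M 0 j c) :
    variableDifferential K c = 0 := by
  ext1 τ
  refine Finset.sum_eq_zero fun x _ => ?_
  have hx : c (insert x τ) = 0 := by
    by_contra hne
    exact Finset.insert_ne_empty x τ (Finset.card_eq_zero.1 (hc.card _ hne))
  rw [hx, smul_zero, smul_zero]

end KoszulHomology

section Multigrading

/-! ### The multigraded pieces of the Koszul complex -/

variable {V K ι : Type*} [Field K] {U : Set (V →₀ ℕ)} {a : V →₀ ℕ} {b : ι} {τ : Finset V}

lemma mem_koszulComplex_iff_le :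
    τ ∈ koszulComplex U a ↔ indicatorVec τ ≤ a ∧ a - indicatorVec τ ∈ U := by
  constructor
  · rintro ⟨b, hb, rfl⟩
    exact ⟨le_add_self, by rwa [add_tsub_cancel_right]⟩
  · exact fun ⟨hle, hU⟩ => ⟨_, hU, tsub_add_cancel_of_le hle⟩

open Classical in
/-- The coefficients of the chain `c` in the multidegree `a` and the coordinate `b`, as a
simplicial chain. -/
def multidegreePart (a : V →₀ ℕ) (b : ι) (c : Finset V → ι → MvPolynomial V K) : Finset V → K :=
  fun τ => if indicatorVec τ ≤ a then coeff (a - indicatorVec τ) (c τ b) else 0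

variable {deg : ι → ℤ} {M : Submodule (MvPolynomial V K) (ι → MvPolynomial V K)}
  {p : ℕ} {j : ℤ} {c c' : Finset V → ι → MvPolynomial V K}

lemma multidegreePart_add_indicatorVec (m : V →₀ ℕ) (b : ι)
    (c : Finset V → ι → MvPolynomial V K) (τ : Finset V) :
    multidegreePart (m + indicatorVec τ) b c τ = coeff m (c τ b) := by
  rw [multidegreePart, if_pos le_add_self, add_tsub_cancel_right]

lemma multidegreePart_ne_zero_iff : multidegreePart a b c τ ≠ 0 ↔
    ∃ m, m + indicatorVec τ = a ∧ coeff m (c τ b) ≠ 0 := by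
  constructor
  · intro h
    obtain ⟨hle, hne⟩ := ite_ne_right_iff.1 h
    exact ⟨_, tsub_add_cancel_of_le hle, hne⟩
  · rintro ⟨m, rfl, hm⟩
    rwa [multidegreePart_add_indicatorVec]

lemma multidegreePart_zero (a : V →₀ ℕ) (b : ι) :
    multidegreePart a b (0 : Finset V → ι → MvPolynomial V K) = 0 := by
  ext τ
  simp [multidegreePart]

lemma ext_multidegreePart (h : ∀ a b, multidegreePart a b c = multidegreePart a b c') :
    c = c' := by
  ext τ b m
  rw [← multidegreePart_add_indicatorVec, ← multidegreePart_add_indicatorVec, h]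

lemma exists_multidegreePart_eq (μ : (V →₀ ℕ) → ι → Finset V → K)
    (hfin : {a | ∃ b, μ a b ≠ 0}.Finite) (hμ : ∀ a b τ, μ a b τ ≠ 0 → indicatorVec τ ≤ a) :
    ∃ c : Finset V → ι → MvPolynomial V K, ∀ a b, multidegreePart a b c = μ a b := by
  classical
  refine ⟨fun τ b => ∑ a ∈ hfin.toFinset, monomial (a - indicatorVec τ) (μ a b τ),
    fun a b => funext fun τ => ?_⟩
  by_cases hτ : indicatorVec τ ≤ a
  · have hother (a' : V →₀ ℕ) (ha' : a' ≠ a) :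
        coeff (a - indicatorVec τ) (monomial (a' - indicatorVec τ) (μ a' b τ)) = 0 := by
      by_contra hne
      rw [coeff_monomial, ite_eq_right_iff, Classical.not_imp] at hne
      refine ha' ?_
      rw [← tsub_add_cancel_of_le (hμ a' b τ hne.2), hne.1, tsub_add_cancel_of_le hτ]
    rw [multidegreePart, if_pos hτ, coeff_sum, Finset.sum_eq_single a fun a' _ => hother a',
      coeff_monomial, if_pos rfl]
    intro ha
    have hab : μ a b = 0 := not_not.1 fun h => ha (hfin.mem_toFinset.2 ⟨b, h⟩)
    rw [hab, Pi.zero_apply, monomial_zero, coeff_zero]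
  · rw [multidegreePart, if_neg hτ]
    exact (not_not.1 (mt (hμ a b τ) hτ)).symm

lemma finite_multidegreePart_ne_zero [Finite V] [Finite ι] (c : Finset V → ι → MvPolynomial V K) :
    {a | ∃ b, multidegreePart a b c ≠ 0}.Finite := by
  refine (Set.finite_iUnion fun τ : Finset V => Set.finite_iUnion fun b : ι =>
    (c τ b).support.finite_toSet.image (· + indicatorVec τ)).subset ?_
  rintro a ⟨b, hab⟩
  obtain ⟨τ, hτ⟩ := Function.ne_iff.1 hab
  obtain ⟨m, hm, hne⟩ := multidegreePart_ne_zero_iff.1 hτ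
  exact Set.mem_iUnion₂.2 ⟨τ, b, m, mem_support_iff.2 hne, hm⟩

/-- The monomials of the elements of `M` are those in `U`, so that the Koszul complex of `M` is the
direct sum of the simplicial chain complexes of the upper Koszul complexes of `U`. -/
lemma isKoszulChain_iff_multidegreePart (hM : ∀ f, f ∈ M ↔ ∀ b, f b ∈ restrictSupport K U) :
    IsKoszulChain deg M p j c ↔
      ∀ a b, multidegreePart a b c ∈ simplicialChains K (koszulComplex U a) p ∧
        (multidegreePart a b c ≠ 0 → (a.degree : ℤ) + deg b = j) := by
  constructor
  · intro hc a b
    have hface (τ) (hτ : multidegreePart a b c τ ≠ 0) :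
        τ ∈ koszulComplex U a ∧ τ.card = p ∧ (a.degree : ℤ) + deg b = j := by
      obtain ⟨m, rfl, hm⟩ := multidegreePart_ne_zero_iff.1 hτ
      have hcard : τ.card = p := hc.card τ fun h => hm (by rw [h, Pi.zero_apply, coeff_zero])
      have hdeg := hc.isHomogeneous τ b m (mem_support_iff.2 hm)
      refine ⟨⟨m, (hM _).1 (hc.mem τ) b (mem_support_iff.2 hm), rfl⟩, hcard, ?_⟩
      rw [map_add, degree_indicatorVec, hcard]
      push_cast
      omega
    refine ⟨mem_simplicialChains.2 fun τ hτ => ⟨(hface τ hτ).1, (hface τ hτ).2.1⟩, fun h => ?_⟩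
    obtain ⟨τ, hτ⟩ := Function.ne_iff.1 h
    exact (hface τ hτ).2.2
  · intro h
    have hcoeff (τ b m) (hm : coeff m (c τ b) ≠ 0) :
        m ∈ U ∧ τ.card = p ∧ (m.degree : ℤ) + deg b = j - p := by
      rw [← multidegreePart_add_indicatorVec] at hm
      obtain ⟨⟨m', hm', hmm'⟩, hcard⟩ := mem_simplicialChains.1 (h _ b).1 τ hm
      have hdeg := (h _ b).2 (Function.ne_iff.2 ⟨τ, hm⟩)
      rw [map_add, degree_indicatorVec, hcard] at hdeg
      push_cast at hdeg
      exact ⟨add_right_cancel hmm' ▸ hm', hcard, by omega⟩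
    refine ⟨fun τ => (hM _).2 fun b m hm => (hcoeff τ b m (mem_support_iff.1 hm)).1, fun τ hτ => ?_,
      fun τ b m hm => (hcoeff τ b m (mem_support_iff.1 hm)).2.2⟩
    obtain ⟨b, hb⟩ := Function.ne_iff.1 hτ
    obtain ⟨m, hm⟩ := MvPolynomial.ne_zero_iff.1 hb
    exact (hcoeff τ b m hm).2.1

variable [LinearOrder V] [Fintype V]

lemma multidegreePart_differential (a : V →₀ ℕ) (b : ι) (c : Finset V → ι → MvPolynomial V K) :
    multidegreePart a b (variableDifferential K c) =
      simplicialBoundary (multidegreePart a b c) := by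
  ext τ
  rw [koszulDifferential_apply]
  by_cases hτ : indicatorVec τ ≤ a
  · obtain ⟨m, rfl⟩ := exists_add_of_le hτ
    rw [add_comm, multidegreePart_add_indicatorVec, koszulDifferential_apply, Finset.sum_apply,
      coeff_sum]
    refine Finset.sum_congr rfl fun x hx => ?_
    have hxτ := Finset.mem_compl.1 hx
    rw [Pi.smul_apply, Pi.smul_apply, smul_eq_mul, one_smul, ← Int.cast_smul_eq_zsmul K, coeff_smul,
      Int.cast_smul_eq_zsmul]
    congr 1
    by_cases hmx : m x = 0
    · rw [coeff_X_mul', if_neg (by simpa using hmx), multidegreePart, if_neg]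
      intro hle
      simpa [indicatorVec_apply, hxτ, hmx] using hle x
    · obtain ⟨m, rfl⟩ := exists_eq_add_single hmx
      rw [add_comm m, coeff_X_mul, add_comm _ m, add_assoc, add_comm (single x 1),
        ← indicatorVec_insert hxτ, multidegreePart_add_indicatorVec]
  · rw [multidegreePart, if_neg hτ, Finset.sum_eq_zero]
    intro x hx
    rw [multidegreePart, if_neg, smul_zero, smul_zero]
    rw [indicatorVec_insert (Finset.mem_compl.1 hx)]
    exact fun hle => hτ (le_self_add.trans hle)

lemma exists_differential_eq_of_acyclicAt [Finite ι]
    (hM : ∀ f, f ∈ M ↔ ∀ b, f b ∈ restrictSupport K U) (hc : IsKoszulChain deg M p j c)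
    (hcycle : variableDifferential K c = 0)
    (h : ∀ a b, multidegreePart a b c ≠ 0 → (a.degree : ℤ) + deg b = j →
      AcyclicAt K (koszulComplex U a) p) :
    ∃ c', IsKoszulChain deg M (p + 1) j c' ∧ variableDifferential K c' = c := by
  rw [isKoszulChain_iff_multidegreePart hM] at hc
  have hprimitive (a b) : ∃ μ ∈ simplicialChains K (koszulComplex U a) (p + 1),
      simplicialBoundary μ = multidegreePart a b c ∧ (multidegreePart a b c = 0 → μ = 0) := by
    by_cases hab : multidegreePart a b c = 0
    · exact ⟨0, zero_mem _, by rw [hab, map_zero], fun _ => rfl⟩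
    · obtain ⟨μ, hμ, hbd⟩ := h a b hab ((hc a b).2 hab) _ (hc a b).1
        (by rw [← multidegreePart_differential, hcycle, multidegreePart_zero])
      exact ⟨μ, hμ, hbd, fun h => absurd h hab⟩
  choose μ hμ hbd hzero using hprimitive
  obtain ⟨c', hc'⟩ := exists_multidegreePart_eq μ
    ((finite_multidegreePart_ne_zero c).subset fun a ⟨b, hab⟩ => ⟨b, mt (hzero a b) hab⟩)
    fun a b τ hτ => (mem_koszulComplex_iff_le.1 (mem_simplicialChains.1 (hμ a b) τ hτ).1).1
  refine ⟨c', (isKoszulChain_iff_multidegreePart hM).2 fun a b => ?_,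
    ext_multidegreePart fun a b => by rw [multidegreePart_differential, hc', hbd]⟩
  rw [hc']
  exact ⟨hμ a b, fun hne => (hc a b).2 (mt (hzero a b) hne)⟩

lemma KoszulExactAt.acyclicAt (hM : ∀ f, f ∈ M ↔ ∀ b, f b ∈ restrictSupport K U)
    (h : KoszulExactAt deg M p j) (hab : (a.degree : ℤ) + deg b = j) :
    AcyclicAt K (koszulComplex U a) p := by
  classical
  intro l hl hcycle
  set μ : (V →₀ ℕ) → ι → Finset V → K :=
    fun a' b' => if a' = a ∧ b' = b then l else 0
  have hμab : μ a b = l := if_pos ⟨rfl, rfl⟩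
  have eq_of_ne_zero {a' b'} (hne : μ a' b' ≠ 0) : a' = a ∧ b' = b := (ite_ne_right_iff.1 hne).1
  have hchain (a' b') : μ a' b' ∈ simplicialChains K (koszulComplex U a') p ∧
      simplicialBoundary (μ a' b') = 0 := by
    by_cases hne : μ a' b' = 0
    · rw [hne, map_zero]
      exact ⟨zero_mem _, rfl⟩
    · obtain ⟨rfl, rfl⟩ := eq_of_ne_zero hne
      rw [hμab]
      exact ⟨hl, hcycle⟩
  obtain ⟨c, hc⟩ := exists_multidegreePart_eq μ
    ((Set.finite_singleton a).subset fun a' ⟨b', hne⟩ => (eq_of_ne_zero hne).1)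
    fun a' b' τ hτ => (mem_koszulComplex_iff_le.1
      (mem_simplicialChains.1 (hchain a' b').1 τ hτ).1).1
  obtain ⟨c', hc', hbd⟩ := h c
    ((isKoszulChain_iff_multidegreePart hM).2 fun a' b' => by
      rw [hc]
      refine ⟨(hchain a' b').1, fun hne => ?_⟩
      obtain ⟨rfl, rfl⟩ := eq_of_ne_zero hne
      exact hab)
    (ext_multidegreePart fun a' b' => by
      rw [multidegreePart_differential, hc, (hchain a' b').2, multidegreePart_zero])
  refine ⟨multidegreePart a b c', ((isKoszulChain_iff_multidegreePart hM).1 hc' a b).1, ?_⟩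
  rw [← multidegreePart_differential, hbd, hc, hμab]

lemma koszulExactAt_iff_acyclicAt [Finite ι]
    (hM : ∀ f, f ∈ M ↔ ∀ b, f b ∈ restrictSupport K U) :
    KoszulExactAt deg M p j ↔
      ∀ (a : V →₀ ℕ) (b : ι), (a.degree : ℤ) + deg b = j → AcyclicAt K (koszulComplex U a) p :=
  ⟨fun h _ _ hab => h.acyclicAt hM hab,
    fun h _ hc hcycle => exists_differential_eq_of_acyclicAt hM hc hcycle fun a b _ => h a b⟩

lemma exists_differential_eq_of_coeff_zero [Finite ι] (hc : IsKoszulChain deg ⊤ p j c)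
    (hcycle : variableDifferential K c = 0) (hzero : ∀ b, coeff 0 (c ∅ b) = 0) :
    ∃ c', IsKoszulChain deg ⊤ (p + 1) j c' ∧ variableDifferential K c' = c := by
  refine exists_differential_eq_of_acyclicAt (U := Set.univ) (by simp [restrictSupport_univ]) hc
    hcycle fun a b hab _ => acyclicAt_koszulComplex_univ ?_
  rintro rfl
  obtain ⟨τ, hτ⟩ := Function.ne_iff.1 hab
  obtain ⟨m, hm, hne⟩ := multidegreePart_ne_zero_iff.1 hτ
  obtain ⟨rfl, hτ0⟩ := add_eq_zero.1 hm
  obtain rfl : τ = ∅ := by rw [← Finset.card_eq_zero, ← degree_indicatorVec, hτ0, map_zero]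
  exact hne (hzero b)

end Multigrading

section DimensionShifting

/-! ### Graded Betti numbers and Koszul homology -/

variable {V K ι κ : Type*} [Field K]
  {φ : (ι → MvPolynomial V K) →ₗ[MvPolynomial V K] (κ → MvPolynomial V K)}

lemma variableDifferential_map [LinearOrder V] [Fintype V]
    (c : Finset V → ι → MvPolynomial V K) :
    variableDifferential K (fun τ => φ (c τ)) = fun τ => φ (variableDifferential K c τ) := by
  ext1 τ
  simp only [koszulDifferential_apply, map_sum, map_zsmul, map_smul]

lemma coeff_zero_variableDifferential [LinearOrder V] [Fintype V]
    (f : Finset V → ι → MvPolynomial V K) (τ : Finset V) (b : ι) :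
    coeff 0 (variableDifferential K f τ b) = 0 := by
  rw [koszulDifferential_apply, Finset.sum_apply, coeff_sum]
  refine Finset.sum_eq_zero fun x _ => ?_
  rw [Pi.smul_apply, Pi.smul_apply, smul_eq_mul, ← Int.cast_smul_eq_zsmul K, coeff_smul,
    coeff_X_mul', if_neg (by simp), smul_zero]

variable [Finite ι] [DecidableEq ι] {deg : ι → ℤ} {deg' : κ → ℤ} {p : ℕ} {j : ℤ}

lemma IsKoszulChain.map {M : Submodule (MvPolynomial V K) (ι → MvPolynomial V K)}
    (hφ : IsHomogeneousMap deg deg' φ) {c : Finset V → ι → MvPolynomial V K}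
    (hc : IsKoszulChain deg M p j c) :
    IsKoszulChain deg' (LinearMap.range φ) p j fun τ => φ (c τ) where
  mem τ := LinearMap.mem_range_self φ _
  card τ h := hc.card τ fun h0 => h (by rw [h0, map_zero])
  isHomogeneous τ := by
    rw [← (hc.isHomogeneous τ).homogeneousPart_eq, hφ.map_homogeneousPart]
    exact isHomogeneousVector_homogeneousPart _

lemma IsKoszulChain.exists_lift (hφ : IsHomogeneousMap deg deg' φ)
    {c : Finset V → κ → MvPolynomial V K} (hc : IsKoszulChain deg' (LinearMap.range φ) p j c) :
    ∃ f : Finset V → ι → MvPolynomial V K,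
      IsKoszulChain deg ⊤ p j f ∧ (fun τ => φ (f τ)) = c := by
  classical
  choose g hg using fun τ => LinearMap.mem_range.1 (hc.mem τ)
  refine ⟨fun τ => if c τ = 0 then 0 else homogeneousPart deg (j - p) (g τ), ⟨fun _ => trivial,
    fun τ h => hc.card τ fun h0 => h (if_pos h0), fun τ => ?_⟩, funext fun τ => ?_⟩
  · split_ifs
    · exact isHomogeneousVector_zero
    · exact isHomogeneousVector_homogeneousPart _
  · dsimp only
    split_ifs with h
    · rw [h, map_zero]
    · rw [hφ.map_homogeneousPart, hg, (hc.isHomogeneous τ).homogeneousPart_eq]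

variable [LinearOrder V] [Fintype V]

lemma koszulExactAt_ker_of_range (hφ : IsHomogeneousMap deg deg' φ)
    (hmin : ∀ f ∈ LinearMap.ker φ, ∀ b, coeff 0 (f b) = 0)
    (h : KoszulExactAt deg' (LinearMap.range φ) (p + 1) j) :
    KoszulExactAt deg (LinearMap.ker φ) p j := by
  intro c hc hcycle
  obtain ⟨f, hf, rfl⟩ := exists_differential_eq_of_coeff_zero (hc.of_mem fun _ => trivial) hcycle
    (hmin _ (hc.mem ∅))
  obtain ⟨m, hm, hbd⟩ := h _ (hf.map hφ)
    ((variableDifferential_map f).trans (funext hc.mem))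
  obtain ⟨g, hg, rfl⟩ := hm.exists_lift hφ
  rw [variableDifferential_map] at hbd
  refine ⟨f - variableDifferential K g, (hf.sub hg.differential).of_mem fun τ => ?_, ?_⟩
  · rw [LinearMap.mem_ker, Pi.sub_apply, map_sub, sub_eq_zero]
    exact (congrFun hbd τ).symm
  · rw [map_sub, koszulDifferential_comp_self, sub_zero]

lemma koszulExactAt_range_of_ker (hφ : IsHomogeneousMap deg deg' φ)
    (h : KoszulExactAt deg (LinearMap.ker φ) p j) :
    KoszulExactAt deg' (LinearMap.range φ) (p + 1) j := by
  intro c hc hcycle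
  obtain ⟨f, hf, rfl⟩ := hc.exists_lift hφ
  rw [variableDifferential_map] at hcycle
  obtain ⟨n, hn, hbd⟩ := h (variableDifferential K f) (hf.differential.of_mem (congrFun hcycle))
    (koszulDifferential_comp_self _ _)
  have hsub := hf.sub (hn.of_mem fun _ => Submodule.mem_top)
  have hempty : (f - n) ∅ = 0 := by
    by_contra hne
    exact absurd (hsub.card ∅ hne) (by simp)
  obtain ⟨g, hg, hgf⟩ := exists_differential_eq_of_coeff_zero hsub
    (by rw [map_sub, hbd, sub_self]) fun b => by rw [hempty, Pi.zero_apply, coeff_zero]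
  refine ⟨fun τ => φ (g τ), hg.map hφ, ?_⟩
  rw [variableDifferential_map, hgf]
  ext1 τ
  rw [Pi.sub_apply, map_sub, LinearMap.mem_ker.1 (hn.mem τ), sub_zero]

lemma koszulExactAt_range_succ_iff (hφ : IsHomogeneousMap deg deg' φ)
    (hmin : ∀ f ∈ LinearMap.ker φ, ∀ b, coeff 0 (f b) = 0) :
    KoszulExactAt deg' (LinearMap.range φ) (p + 1) j ↔ KoszulExactAt deg (LinearMap.ker φ) p j :=
  ⟨koszulExactAt_ker_of_range hφ hmin, koszulExactAt_range_of_ker hφ⟩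

lemma koszulExactAt_range_zero_iff (hφ : IsHomogeneousMap deg deg' φ)
    (hmin : ∀ f ∈ LinearMap.ker φ, ∀ b, coeff 0 (f b) = 0) :
    KoszulExactAt deg' (LinearMap.range φ) 0 j ↔ ∀ b, deg b ≠ j := by
  constructor
  · rintro h b rfl
    have hc := IsHomogeneousVector.isKoszulChain_single (hφ b)
      (LinearMap.mem_range_self φ (Pi.single b 1))
    obtain ⟨c', hc', hbd⟩ := h _ hc hc.differential_eq_zero
    obtain ⟨f, -, rfl⟩ := hc'.exists_lift hφ
    have hker : Pi.single b 1 - variableDifferential K f ∅ ∈ LinearMap.ker φ := by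
      rw [LinearMap.mem_ker, map_sub, ← congrFun (variableDifferential_map f) ∅, hbd,
        Pi.single_eq_same, sub_self]
    simpa [coeff_zero_variableDifferential] using hmin _ hker b
  · intro h c hc _
    obtain ⟨f, hf, rfl⟩ := hc.exists_lift hφ
    obtain ⟨g, hg, rfl⟩ := exists_differential_eq_of_coeff_zero hf hf.differential_eq_zero
      fun b => notMem_support_iff.1 fun hb => h b (by simpa using hf.isHomogeneous ∅ b 0 hb)
    exact ⟨fun τ => φ (g τ), hg.map hφ, variableDifferential_map g⟩

end DimensionShifting

section BettiNumbers

variable {V K : Type*} [Field K] {I : Ideal (MvPolynomial V K)}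

namespace MinimalGradedFreeResolution

variable (F : MinimalGradedFreeResolution I)

/-- The augmentation `F 0 → I ⊆ S` with values in the free module of rank one. -/
def vectorAug : (Fin (F.rank 0) → MvPolynomial V K) →ₗ[MvPolynomial V K]
    (Fin 1 → MvPolynomial V K) :=
  LinearMap.pi fun _ => F.aug

lemma isHomogeneousMap_vectorAug : IsHomogeneousMap (F.deg 0) 0 F.vectorAug := fun b _ m hm => by
  rw [Pi.zero_apply, add_zero]
  exact F.aug_homogeneous b m hm

lemma ker_vectorAug : LinearMap.ker F.vectorAug = LinearMap.range (F.d 0) := by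
  rw [vectorAug, LinearMap.ker_pi, ciInf_const, F.exact_zero]

lemma range_vectorAug : LinearMap.range F.vectorAug = Submodule.pi Set.univ fun _ => I := by
  ext f
  simp only [Submodule.mem_pi, Set.mem_univ, true_imp_iff, Fin.forall_fin_one, ← F.range_aug,
    LinearMap.mem_range, funext_iff, vectorAug, LinearMap.pi_apply]

lemma coeff_zero_of_mem_range_d (i : ℕ) :
    ∀ f ∈ LinearMap.range (F.d i), ∀ b, coeff 0 (f b) = 0 := by
  rintro _ ⟨g, rfl⟩ b
  rw [← Finset.univ_sum_single g, map_sum, Finset.sum_apply, coeff_sum]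
  refine Finset.sum_eq_zero fun c _ => ?_
  rw [single_eq_smul_single_one, map_smul, Pi.smul_apply, smul_eq_mul, ← constantCoeff_eq, map_mul,
    F.minimal, mul_zero]

lemma koszulExactAt_range_d_iff [LinearOrder V] [Fintype V] (q : ℕ) :
    ∀ (i k : ℕ) (_ : k = i + 1 + q) (j : ℤ),
        KoszulExactAt (F.deg i) (LinearMap.range (F.d i)) q j ↔ ∀ b, F.deg k b ≠ j := by
  induction q with
  | zero =>
    rintro i _ rfl j
    exact koszulExactAt_range_zero_iff (F.d_homogeneous i)
      (F.exact_succ i ▸ F.coeff_zero_of_mem_range_d (i + 1))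
  | succ q ih =>
    rintro i _ rfl j
    rw [koszulExactAt_range_succ_iff (F.d_homogeneous i)
      (F.exact_succ i ▸ F.coeff_zero_of_mem_range_d (i + 1)), F.exact_succ]
    exact ih (i + 1) _ (by ring) j

lemma koszulExactAt_iff [LinearOrder V] [Fintype V] (i : ℕ) (j : ℤ) :
    KoszulExactAt 0 (Submodule.pi Set.univ fun _ : Fin 1 => I) i j ↔ ∀ b, F.deg i b ≠ j := by
  have hmin := F.ker_vectorAug ▸ F.coeff_zero_of_mem_range_d 0
  rw [← F.range_vectorAug]
  cases i with
  | zero => exact koszulExactAt_range_zero_iff F.isHomogeneousMap_vectorAug hmin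
  | succ i =>
    rw [koszulExactAt_range_succ_iff F.isHomogeneousMap_vectorAug hmin, F.ker_vectorAug]
    exact F.koszulExactAt_range_d_iff i 0 _ (by ring) j

end MinimalGradedFreeResolution

end BettiNumbers

section GradedSubmodules

/-! ### Existence of minimal graded free resolutions -/

variable {V K ι κ : Type*} [Field K] {deg : ι → ℤ} {deg' : κ → ℤ} {n : ℕ} {e : Fin n → ℤ}
  {M : Submodule (MvPolynomial V K) (ι → MvPolynomial V K)} {g : Fin n → ι → MvPolynomial V K}

/-- `M` is a graded submodule of the graded free module `⨁ b, S(-deg b)`. -/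
def IsGradedSubmodule (deg : ι → ℤ)
    (M : Submodule (MvPolynomial V K) (ι → MvPolynomial V K)) : Prop :=
  ∀ f ∈ M, ∀ j, homogeneousPart deg j f ∈ M

lemma IsHomogeneousMap.isGradedSubmodule_ker [Finite ι] [DecidableEq ι]
    {φ : (ι → MvPolynomial V K) →ₗ[MvPolynomial V K] (κ → MvPolynomial V K)}
    (hφ : IsHomogeneousMap deg deg' φ) : IsGradedSubmodule deg (LinearMap.ker φ) := by
  intro f hf j
  rw [LinearMap.mem_ker, hφ.map_homogeneousPart, LinearMap.mem_ker.1 hf, map_zero]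

/-- `M` is generated by `n` homogeneous elements. -/
def HasHomogeneousGenerators (deg : ι → ℤ)
    (M : Submodule (MvPolynomial V K) (ι → MvPolynomial V K)) (n : ℕ) : Prop :=
  ∃ (g : Fin n → ι → MvPolynomial V K) (e : Fin n → ℤ),
    (∀ b, IsHomogeneousVector deg (g b) (e b)) ∧ Submodule.span (MvPolynomial V K) (Set.range g) = M

lemma exists_sum_homogeneousPart_eq [Finite ι] (deg : ι → ℤ) (f : ι → MvPolynomial V K) :
    ∃ J : Finset ℤ, ∑ j ∈ J, homogeneousPart deg j f = f := by
  classical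
  have := Fintype.ofFinite ι
  refine ⟨Finset.univ.biUnion fun b => (f b).support.image fun m => (m.degree : ℤ) + deg b, ?_⟩
  ext b m
  simp only [Finset.sum_apply, coeff_sum, coeff_homogeneousPart]
  rw [Finset.sum_ite_eq, ite_eq_left_iff]
  refine fun h => (notMem_support_iff.1 fun hm => h ?_).symm
  exact Finset.mem_biUnion.2 ⟨b, Finset.mem_univ b, Finset.mem_image_of_mem _ hm⟩

lemma IsGradedSubmodule.exists_hasHomogeneousGenerators [Finite V] [Finite ι]
    (hM : IsGradedSubmodule deg M) : ∃ n, HasHomogeneousGenerators deg M n := by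
  obtain ⟨n, g, rfl⟩ := Submodule.fg_iff_exists_fin_generating_family.1 (IsNoetherian.noetherian M)
  choose J hJ using fun i => exists_sum_homogeneousPart_eq deg (g i)
  let φ := Fintype.equivFin (Σ i, J i)
  refine ⟨_, fun k => homogeneousPart deg (φ.symm k).2 (g (φ.symm k).1), fun k => (φ.symm k).2,
    fun b => isHomogeneousVector_homogeneousPart _, le_antisymm ?_ ?_⟩ <;> rw [Submodule.span_le]
  · rintro _ ⟨k, rfl⟩
    exact hM _ (Submodule.subset_span ⟨_, rfl⟩) _
  · rintro _ ⟨i, rfl⟩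
    rw [SetLike.mem_coe, ← hJ i]
    refine Submodule.sum_mem _ fun j hj => Submodule.subset_span ⟨φ ⟨i, j, hj⟩, ?_⟩
    dsimp only
    rw [Equiv.symm_apply_apply]

lemma isHomogeneousMap_linearCombination (hg : ∀ b, IsHomogeneousVector deg (g b) (e b)) :
    IsHomogeneousMap e deg (Fintype.linearCombination (MvPolynomial V K) g) := by
  intro b
  rw [Fintype.linearCombination_apply_single, one_smul]
  exact hg b

lemma homogeneousPart_deg_apply (f : ι → MvPolynomial V K) (b : ι) :
    homogeneousPart deg (deg b) f b = C (coeff 0 (f b)) := by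
  classical
  ext m
  rw [coeff_homogeneousPart, coeff_C]
  rcases eq_or_ne m 0 with rfl | hm
  · rw [if_pos (by simp), if_pos rfl]
  · rw [if_neg hm.symm, if_neg]
    have := (Finsupp.degree_eq_zero_iff m).not.2 hm
    omega

-- The component of degree `e b` of a relation with nonzero constant term at `b` expresses `g b`
-- through the other generators.
lemma span_succAbove_of_relation {g : Fin (n + 1) → ι → MvPolynomial V K} {e : Fin (n + 1) → ℤ}
    (hg : ∀ b, IsHomogeneousVector deg (g b) (e b)) {f : Fin (n + 1) → MvPolynomial V K}
    (hf : Fintype.linearCombination (MvPolynomial V K) g f = 0) {b : Fin (n + 1)}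
    (hb : coeff 0 (f b) ≠ 0) :
    Submodule.span (MvPolynomial V K) (Set.range (g ∘ b.succAbove)) =
      Submodule.span (MvPolynomial V K) (Set.range g) := by
  set N := Submodule.span (MvPolynomial V K) (Set.range (g ∘ b.succAbove))
  refine le_antisymm (Submodule.span_mono (Set.range_comp_subset_range _ _)) ?_
  have hother : ∀ k, g (b.succAbove k) ∈ N := fun k => Submodule.subset_span ⟨k, rfl⟩
  have hrelation : (C (coeff 0 (f b)) : MvPolynomial V K) • g b +
      ∑ k, homogeneousPart e (e b) f (b.succAbove k) • g (b.succAbove k) = 0 := by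
    rw [← homogeneousPart_deg_apply (deg := e) f b,
      ← Fin.sum_univ_succAbove fun k => homogeneousPart e (e b) f k • g k]
    exact (isHomogeneousMap_linearCombination hg).isGradedSubmodule_ker f hf (e b)
  have hgb : g b ∈ N := by
    have h : (C (coeff 0 (f b)) : MvPolynomial V K) • g b ∈ N := by
      rw [eq_neg_of_add_eq_zero_left hrelation]
      exact neg_mem (sum_mem fun k _ => N.smul_mem _ (hother k))
    simpa [smul_smul, ← C_mul, hb] using N.smul_mem (C (coeff 0 (f b))⁻¹) h
  rw [Submodule.span_le, Set.range_subset_iff]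
  exact fun i => Fin.succAboveCases b hgb hother i

/-- A surjection of a graded free module `⨁ b : Fin rank, S(-deg b)` onto the graded submodule `M`
whose kernel lies in the submodule generated by the multiples of the variables. -/
structure MinimalCover (targetDeg : ι → ℤ)
    (M : Submodule (MvPolynomial V K) (ι → MvPolynomial V K)) where
  /-- the rank of the free module -/
  rank : ℕ
  /-- the degrees of its basis elements -/
  deg : Fin rank → ℤ
  /-- the surjection -/
  map : (Fin rank → MvPolynomial V K) →ₗ[MvPolynomial V K] (ι → MvPolynomial V K)
  isHomogeneousMap : IsHomogeneousMap deg targetDeg map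
  range_eq : LinearMap.range map = M
  coeff_zero_of_mem_ker : ∀ f ∈ LinearMap.ker map, ∀ b, coeff 0 (f b) = 0

lemma IsGradedSubmodule.nonempty_minimalCover [Finite V] [Finite ι]
    (hM : IsGradedSubmodule deg M) : Nonempty (MinimalCover deg M) := by
  classical
  have hex := hM.exists_hasHomogeneousGenerators
  obtain ⟨g, e, hg, hspan⟩ := Nat.find_spec hex
  have hminimal := fun n => @Nat.find_min _ _ hex n
  generalize Nat.find hex = n at g e hg hspan hminimal
  refine ⟨⟨n, e, Fintype.linearCombination _ g, isHomogeneousMap_linearCombination hg,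
    by rw [Fintype.range_linearCombination, hspan], fun f hf b => ?_⟩⟩
  by_contra hb
  cases n with
  | zero => exact b.elim0
  | succ n =>
    exact hminimal n n.lt_succ_self ⟨g ∘ b.succAbove, e ∘ b.succAbove, fun _ => hg _,
      (span_succAbove_of_relation hg hf hb).trans hspan⟩

end GradedSubmodules

section Existence

variable {V K : Type*} [Field K]

variable (V K) in
/-- A graded submodule, without constant terms, of a graded free module of finite rank; bundled with
the free module so that passing to syzygies can be iterated. -/
structure SyzygyModule where
  /-- the rank of the free module -/
  rank : ℕ
  /-- the degrees of its basis elements -/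
  deg : Fin rank → ℤ
  /-- the submodule -/
  carrier : Submodule (MvPolynomial V K) (Fin rank → MvPolynomial V K)
  isGradedSubmodule : IsGradedSubmodule deg carrier
  coeff_zero_of_mem : ∀ f ∈ carrier, ∀ b, coeff 0 (f b) = 0

/-- The kernel of a minimal cover. -/
def MinimalCover.syzygy {ι : Type*} {targetDeg : ι → ℤ}
    {M : Submodule (MvPolynomial V K) (ι → MvPolynomial V K)} (C : MinimalCover targetDeg M) :
    SyzygyModule V K where
  rank := C.rank
  deg := C.deg
  carrier := LinearMap.ker C.map
  isGradedSubmodule := C.isHomogeneousMap.isGradedSubmodule_ker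
  coeff_zero_of_mem := C.coeff_zero_of_mem_ker

lemma isGradedSubmodule_pi {I : Ideal (MvPolynomial V K)} (ι : Type*)
    (hI : ∀ f ∈ I, ∀ n, homogeneousComponent n f ∈ I) :
    IsGradedSubmodule (0 : ι → ℤ) (Submodule.pi Set.univ fun _ => I) := by
  intro f hf j b _
  change (if (0 : ℤ) ≤ j then homogeneousComponent (j - 0).toNat else 0) (f b) ∈ I
  split_ifs
  · exact hI _ (hf b trivial) _
  · exact I.zero_mem

variable [Finite V]

namespace SyzygyModule

/-- A minimal cover of `P`. -/
def cover (P : SyzygyModule V K) : MinimalCover P.deg P.carrier :=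
  P.isGradedSubmodule.nonempty_minimalCover.some

/-- The iterated syzygy modules of `P`. -/
def syzygies (P : SyzygyModule V K) : ℕ → SyzygyModule V K
  | 0 => P
  | i + 1 => (P.syzygies i).cover.syzygy

end SyzygyModule

theorem nonempty_minimalGradedFreeResolution {I : Ideal (MvPolynomial V K)}
    (hI : ∀ f ∈ I, ∀ n, homogeneousComponent n f ∈ I) :
    Nonempty (MinimalGradedFreeResolution I) := by
  obtain ⟨C⟩ := (isGradedSubmodule_pi (Fin 1) hI).nonempty_minimalCover
  let P := C.syzygy.syzygies
  let e : (Fin 1 → MvPolynomial V K) ≃ₗ[MvPolynomial V K] MvPolynomial V K :=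
    LinearEquiv.funUnique (Fin 1) _ _
  have hrange : LinearMap.range (e.toLinearMap ∘ₗ C.map) = I := by
    rw [LinearMap.range_comp, C.range_eq]
    ext f
    simp [e, Submodule.mem_pi]
  exact ⟨{
    rank i := (P i).rank
    deg i := (P i).deg
    aug := e.toLinearMap ∘ₗ C.map
    d i := (P i).cover.map
    aug_homogeneous b m hm := (add_zero _).symm.trans (C.isHomogeneousMap b 0 m hm)
    d_homogeneous i := (P i).cover.isHomogeneousMap
    range_aug := hrange
    exact_zero := (LinearEquiv.ker_comp _ _).trans (P 0).cover.range_eq.symm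
    exact_succ i := (P (i + 1)).cover.range_eq.symm
    minimal i b c := (P i).coeff_zero_of_mem _
      ((P i).cover.range_eq.le (LinearMap.mem_range_self _ _)) c }⟩

end Existence

section Regularity

/-! ### Regularity of monomial ideals -/

variable {V K : Type*} [Field K]

lemma le_of_forall_intCast_le {x y : WithBot (WithTop ℤ)}
    (h : ∀ r : ℤ, y ≤ ((r : WithTop ℤ) : WithBot (WithTop ℤ)) →
      x ≤ ((r : WithTop ℤ) : WithBot (WithTop ℤ))) : x ≤ y := by
  induction y with
  | bot =>
    induction x with
    | bot => exact le_rfl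
    | coe x =>
      induction x with
      | top => exact absurd (WithBot.coe_le_coe.1 (h 0 bot_le)) (WithTop.coe_lt_top 0).not_ge
      | coe x =>
        have := h (x - 1) bot_le
        norm_cast at this
        omega
  | coe y =>
    induction y with
    | top => exact le_top
    | coe y => exact h y le_rfl

lemma le_coe_sub_of_add_le {x : WithBot (WithTop ℤ)} {n : ℕ} {r : ℤ}
    (h : x + (n : WithBot (WithTop ℤ)) ≤ ((r : WithTop ℤ) : WithBot (WithTop ℤ))) :
    x ≤ (((r - n : ℤ) : WithTop ℤ) : WithBot (WithTop ℤ)) := by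
  induction x with
  | bot => exact bot_le
  | coe x =>
    induction x with
    | top => exact absurd h (by change ¬ (⊤ ≤ _); simp)
    | coe x =>
      have h' : x + n ≤ r := by exact_mod_cast h
      norm_cast
      omega

variable {U : Set (V →₀ ℕ)} {hU : IsUpperSet U}

lemma homogeneousComponent_mem_restrictSupportIdeal {f : MvPolynomial V K}
    (hf : f ∈ restrictSupportIdeal K U hU) (n : ℕ) :
    homogeneousComponent n f ∈ restrictSupportIdeal K U hU := by
  change ↑(homogeneousComponent n f).support ⊆ U
  rw [support_homogeneousComponent, Finset.coe_filter]
  exact fun m hm => hf hm.1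

lemma gradedBetti_ne_zero_iff {I : Ideal (MvPolynomial V K)} {i : ℕ} {j : ℤ}
    (h : Nonempty (MinimalGradedFreeResolution I)) :
    gradedBetti I i j ≠ 0 ↔ ∃ b, h.some.deg i b = j := by
  rw [gradedBetti, dif_pos h, Nat.card_ne_zero]
  simp [nonempty_subtype, Subtype.finite]

variable [LinearOrder V] [Fintype V]

/-- Hochster's formula for the vanishing of the graded Betti numbers of a monomial ideal. -/
theorem gradedBetti_restrictSupportIdeal_eq_zero_iff {i : ℕ} {j : ℤ} :
    gradedBetti (restrictSupportIdeal K U hU) i j = 0 ↔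
      ∀ a : V →₀ ℕ, (a.degree : ℤ) = j → AcyclicAt K (koszulComplex U a) i := by
  have h := nonempty_minimalGradedFreeResolution (I := restrictSupportIdeal K U hU)
    fun _ hf => homogeneousComponent_mem_restrictSupportIdeal hf
  have hM (f : Fin 1 → MvPolynomial V K) :
      f ∈ Submodule.pi Set.univ (fun _ : Fin 1 => restrictSupportIdeal K U hU) ↔
        ∀ b, f b ∈ restrictSupport K U := by
    rw [Submodule.mem_pi]
    exact forall_congr' fun _ => true_imp_iff
  rw [← not_iff_not, ← ne_eq, gradedBetti_ne_zero_iff h, ← not_iff_not, not_not, not_exists,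
    ← h.some.koszulExactAt_iff i j, koszulExactAt_iff_acyclicAt hM]
  simp

theorem regularity_restrictSupportIdeal_le_iff {r : ℤ} :
    regularity (restrictSupportIdeal K U hU) ≤ ((r : WithTop ℤ) : WithBot (WithTop ℤ)) ↔
      RegularityLE K U r := by
  rw [regularity, sSup_le_iff]
  constructor
  · intro h a p hp
    refine gradedBetti_restrictSupportIdeal_eq_zero_iff (hU := hU).1 ?_ a rfl
    by_contra hne
    exact hp.not_ge (WithTop.coe_le_coe.1 (WithBot.coe_le_coe.1 (h _ ⟨p, _, hne, rfl⟩)))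
  · rintro h _ ⟨i, j, hne, rfl⟩
    norm_cast
    by_contra! hlt
    exact hne (gradedBetti_restrictSupportIdeal_eq_zero_iff.2 fun a ha => h a i (by omega))

end Regularity

section MonomialIdeals

/-! ### Powers and symbolic powers of edge ideals -/

variable {V R : Type*} [CommRing R] {U U' : Set (V →₀ ℕ)} {hU : IsUpperSet U}
  {hU' : IsUpperSet U'}

lemma restrictSupportIdeal_mono (h : U ⊆ U') :
    restrictSupportIdeal R U hU ≤ restrictSupportIdeal R U' hU' :=
  restrictSupport_mono R h

lemma span_monomial_image (s : Set (V →₀ ℕ)) :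
    Ideal.span ((fun m => monomial m (1 : R)) '' s) =
      restrictSupportIdeal R (upperClosure s) (upperClosure s).upper := by
  ext f
  rw [mem_ideal_span_monomial_image]
  exact forall₂_congr fun _ _ => mem_upperClosure.symm

lemma restrictSupportIdeal_sup :
    restrictSupportIdeal R U hU ⊔ restrictSupportIdeal R U' hU' =
      restrictSupportIdeal R (U ∪ U') (hU.union hU') := by
  refine le_antisymm (sup_le (restrictSupportIdeal_mono Set.subset_union_left)
    (restrictSupportIdeal_mono Set.subset_union_right)) fun f hf => ?_
  rw [← support_sum_monomial_coeff f]
  refine Ideal.sum_mem _ fun m hm => ?_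
  rcases hf hm with h | h
  · exact Ideal.mem_sup_left ((monomial_mem_restrictSupport R).2 (.inl h))
  · exact Ideal.mem_sup_right ((monomial_mem_restrictSupport R).2 (.inl h))

end MonomialIdeals

section EdgeIdealPowers

variable {V K : Type*} [Field K] {G : SimpleGraph V} {s : ℕ}

lemma edgeIdeal_eq_span : edgeIdeal K G = Ideal.span ((fun m => monomial m (1 : K)) ''
    {m | ∃ u v, G.Adj u v ∧ m = single u 1 + single v 1}) := by
  have hX (u v : V) : (X u * X v : MvPolynomial V K) = monomial (single u 1 + single v 1) 1 := by
    rw [X, X, monomial_mul, mul_one]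
  rw [edgeIdeal]
  congr 1
  ext f
  constructor
  · rintro ⟨u, v, huv, rfl⟩
    exact ⟨_, ⟨u, v, huv, rfl⟩, (hX u v).symm⟩
  · rintro ⟨_, ⟨u, v, huv, rfl⟩, rfl⟩
    exact ⟨u, v, huv, (hX u v).symm⟩

lemma edgeIdeal_pow_eq_span (s : ℕ) : edgeIdeal K G ^ s =
    Ideal.span ((fun m => monomial m (1 : K)) '' {m | IsEdgeProduct G s m}) := by
  induction s with
  | zero =>
    simp_rw [isEdgeProduct_zero, Set.ofPred_eq_eq_singleton, Set.image_singleton, pow_zero]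
    rw [Ideal.one_eq_top, monomial_zero', C_1, Ideal.span_singleton_one]
  | succ s ih =>
    rw [pow_succ, ih, edgeIdeal_eq_span, Ideal.span_mul_span']
    congr 1
    ext f
    constructor
    · rintro ⟨_, ⟨m, hm, rfl⟩, _, ⟨_, ⟨u, v, huv, rfl⟩, rfl⟩, rfl⟩
      exact ⟨_, isEdgeProduct_succ.2 ⟨m, u, v, hm, huv, rfl⟩, by
        simp only [monomial_mul, mul_one]⟩
    · rintro ⟨_, hm, rfl⟩
      obtain ⟨m, u, v, hm', huv, rfl⟩ := isEdgeProduct_succ.1 hm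
      exact ⟨_, ⟨m, hm', rfl⟩, _, ⟨_, ⟨u, v, huv, rfl⟩, rfl⟩, by simp only [monomial_mul, mul_one]⟩

theorem edgeIdeal_pow_eq_restrictSupportIdeal (s : ℕ) : edgeIdeal K G ^ s =
    restrictSupportIdeal K (powerMonomials G s) (isUpperSet_powerMonomials s) := by
  rw [edgeIdeal_pow_eq_span, span_monomial_image]
  rfl

lemma powerMonomials_one : powerMonomials G 1 = edgeMonomials G.Adj := by
  classical
  ext a
  simp only [powerMonomials, isEdgeProduct_succ, isEdgeProduct_zero, Set.mem_ofPred_eq]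
  constructor
  · rintro ⟨_, ⟨_, u, v, rfl, huv, rfl⟩, hle⟩
    refine ⟨u, v, huv, fun hu => ?_, fun hv => ?_⟩
    · simpa [hu] using hle u
    · simpa [hv] using hle v
  · rintro ⟨u, v, huv, hu, hv⟩
    refine ⟨_, ⟨0, u, v, rfl, huv, rfl⟩, fun x => ?_⟩
    have := huv.ne
    simp only [zero_add, Finsupp.add_apply, Finsupp.single_apply]
    split_ifs <;> subst_vars <;> first | contradiction | omega

theorem edgeIdeal_eq_restrictSupportIdeal : edgeIdeal K G =
    restrictSupportIdeal K (edgeMonomials G.Adj) isUpperSet_edgeMonomials := by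
  simpa only [pow_one, powerMonomials_one] using edgeIdeal_pow_eq_restrictSupportIdeal (K := K) 1

lemma powerMonomials_subset_symbolicMonomials (s : ℕ) :
    powerMonomials G s ⊆ symbolicMonomials G s :=
  fun _ ⟨_, hm, hle⟩ _ hC => (hm.le_sum hC).trans (Finset.sum_le_sum fun x _ => hle x)

end EdgeIdealPowers

section VanishingOrder

variable {V R : Type*} [CommRing R] {C : Finset V} {f g : MvPolynomial V R} {x : V} {t : ℕ}

open Classical in
/-- The order of vanishing of `f` along the linear subspace where the variables in `C` are zero,
that is, the order of `f` in the `(X x : x ∈ C)`-adic filtration. -/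
def orderAlong (C : Finset V) (f : MvPolynomial V R) : ℕ∞ :=
  MvPowerSeries.weightedOrder (fun x => if x ∈ C then 1 else 0) (f : MvPowerSeries V R)

lemma le_orderAlong_iff : (t : ℕ∞) ≤ orderAlong C f ↔ ∀ m ∈ f.support, t ≤ ∑ x ∈ C, m x := by
  classical
  have hw (m : V →₀ ℕ) : Finsupp.weight (fun x => if x ∈ C then 1 else 0) m = ∑ x ∈ C, m x := by
    rw [Finsupp.weight_apply, Finsupp.sum_of_support_subset m
      (Finset.subset_union_left (s₂ := C)) _ (by simp)]
    simp [Finset.inter_eq_right.2 Finset.subset_union_right]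
  constructor
  · intro h m hm
    have := h.trans (MvPowerSeries.weightedOrder_le (d := m) _
      (by rwa [coeff_coe, ← mem_support_iff]))
    rw [hw] at this
    exact_mod_cast this
  · refine fun h => MvPowerSeries.nat_le_weightedOrder _ fun m hm => ?_
    rw [coeff_coe, ← notMem_support_iff]
    exact fun hmf => (hw m ▸ hm).not_ge (h m hmf)

/-- The ideal of the linear subspace where the variables in `C` vanish. -/
abbrev variableIdeal (R : Type*) [CommRing R] (C : Finset V) : Ideal (MvPolynomial V R) :=
  Ideal.span (X '' (C : Set V))

lemma mem_variableIdeal_iff : f ∈ variableIdeal R C ↔ orderAlong C f ≠ 0 := by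
  rw [mem_ideal_span_X_image, ← Order.one_le_iff_ne_zero, ← Nat.cast_one, le_orderAlong_iff]
  refine forall₂_congr fun m _ => ?_
  rw [Nat.one_le_iff_ne_zero, ne_eq, Finset.sum_eq_zero_iff]
  simp

lemma X_mem_variableIdeal_iff [Nontrivial R] : (X x : MvPolynomial V R) ∈ variableIdeal R C ↔
    x ∈ C := by
  classical
  rw [mem_ideal_span_X_image]
  simp [support_X, Finsupp.single_apply]

lemma orderAlong_mul [NoZeroDivisors R] :
    orderAlong C (f * g) = orderAlong C f + orderAlong C g := by
  rw [orderAlong, coe_mul, MvPowerSeries.weightedOrder_mul, orderAlong, orderAlong]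

lemma isPrime_variableIdeal [IsDomain R] : (variableIdeal R C).IsPrime := by
  refine Ideal.isPrime_iff.2 ⟨?_, fun h => ?_⟩
  · rw [Ideal.ne_top_iff_one, mem_variableIdeal_iff, orderAlong, coe_one,
      MvPowerSeries.weightedOrder_one, not_not]
  · rwa [mem_variableIdeal_iff, orderAlong_mul, ne_eq, add_eq_zero, not_and_or,
      ← ne_eq, ← ne_eq, ← mem_variableIdeal_iff, ← mem_variableIdeal_iff] at h

variable [Finite V] {p : Ideal (MvPolynomial V R)}

/-- The set of variables contained in the ideal `p`. For `p` a prime ideal containing an edge ideal,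
it is a vertex cover. -/
def variablesIn (p : Ideal (MvPolynomial V R)) : Finset V := (Set.toFinite {x | X x ∈ p}).toFinset

lemma mem_variablesIn : x ∈ variablesIn p ↔ X x ∈ p := by
  simp [variablesIn]

lemma variableIdeal_le_iff : variableIdeal R C ≤ p ↔ C ⊆ variablesIn p := by
  rw [Ideal.span_le, Set.image_subset_iff]
  exact forall₂_congr fun _ _ => mem_variablesIn.symm

end VanishingOrder

lemma mem_symbolicPower_iff {R : Type*} [CommRing R] {I : Ideal R} {t : ℕ} {f : R} :
    f ∈ I.symbolicPower t ↔ ∀ p ∈ I.minimalPrimes, ∃ c, c ∉ p ∧ c * f ∈ I ^ t := by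
  rw [Ideal.symbolicPower, Submodule.mem_iInf, Subtype.forall]
  refine forall₂_congr fun p hp => ?_
  have : p.IsPrime := Ideal.IsMinimalPrime.isPrime hp
  rw [LinearMap.mem_ker, LinearMap.comp_apply, IsLocalizedModule.eq_zero_iff p.primeCompl,
    Subtype.exists]
  refine exists_congr fun c => ?_
  rw [← smul_eq_mul, ← Submodule.Quotient.mk_eq_zero (I ^ t)]
  exact ⟨fun ⟨hc, h⟩ => ⟨hc, h⟩, fun ⟨hc, h⟩ => ⟨hc, h⟩⟩

section EdgeIdealSymbolicPowers

variable {V K : Type*} [Field K] {G : SimpleGraph V} {C : Finset V} {t : ℕ}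

lemma edgeIdeal_le_variableIdeal (hC : G.IsVertexCover C) :
    edgeIdeal K G ≤ variableIdeal K C := by
  refine Ideal.span_le.2 ?_
  rintro _ ⟨u, v, huv, rfl⟩
  rcases hC huv with h | h
  · exact Ideal.mul_mem_right _ _ (X_mem_variableIdeal_iff.2 h)
  · exact Ideal.mul_mem_left _ _ (X_mem_variableIdeal_iff.2 h)

variable [Finite V] {p : Ideal (MvPolynomial V K)}

lemma isVertexCover_variablesIn [hp : p.IsPrime] (h : edgeIdeal K G ≤ p) :
    G.IsVertexCover (variablesIn p) := fun u v huv => by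
  have huv : (X u * X v : MvPolynomial V K) ∈ p := h (Ideal.subset_span ⟨u, v, huv, rfl⟩)
  exact (hp.mem_or_mem huv).imp mem_variablesIn.2 mem_variablesIn.2

lemma exists_adj_notMem_variablesIn (hp : p ∈ (edgeIdeal K G).minimalPrimes) {x : V}
    (hx : x ∈ variablesIn p) : ∃ y, G.Adj x y ∧ y ∉ variablesIn p := by
  classical
  have : p.IsPrime := Ideal.IsMinimalPrime.isPrime hp
  by_contra! hcon
  have herase : G.IsVertexCover ((variablesIn p).erase x : Finset V) := by
    intro u v huv
    rcases eq_or_ne u x with rfl | hux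
    · exact .inr (Finset.mem_erase.2 ⟨huv.ne', hcon v huv⟩)
    rcases eq_or_ne v x with rfl | hvx
    · exact .inl (Finset.mem_erase.2 ⟨hux, hcon u huv.symm⟩)
    · exact (isVertexCover_variablesIn hp.1.2 huv).imp
        (fun h => Finset.mem_erase.2 ⟨hux, h⟩) fun h => Finset.mem_erase.2 ⟨hvx, h⟩
  have hle := hp.2 ⟨isPrime_variableIdeal, edgeIdeal_le_variableIdeal herase⟩
    (variableIdeal_le_iff.2 (Finset.erase_subset x _))
  exact Finset.notMem_erase x _ (X_mem_variableIdeal_iff.1 (hle (mem_variablesIn.1 hx)))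

lemma le_orderAlong_of_mem_symbolicPower {f : MvPolynomial V K} (hC : G.IsVertexCover C)
    (hf : f ∈ (edgeIdeal K G).symbolicPower t) : (t : ℕ∞) ≤ orderAlong C f := by
  have : (variableIdeal K C).IsPrime := isPrime_variableIdeal
  obtain ⟨p, hp, hpC⟩ := Ideal.exists_minimalPrimes_le (edgeIdeal_le_variableIdeal (K := K) hC)
  have : p.IsPrime := Ideal.IsMinimalPrime.isPrime hp
  have hcover := isVertexCover_variablesIn hp.1.2
  obtain ⟨c, hc, hcf⟩ := mem_symbolicPower_iff.1 hf p hp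
  have hc₀ : orderAlong (variablesIn p) c = 0 := by
    by_contra h
    exact hc (variableIdeal_le_iff.2 subset_rfl (mem_variableIdeal_iff.2 h))
  have hle : (t : ℕ∞) ≤ orderAlong (variablesIn p) (c * f) := by
    rw [edgeIdeal_pow_eq_restrictSupportIdeal] at hcf
    exact le_orderAlong_iff.2 fun m hm =>
      powerMonomials_subset_symbolicMonomials t (hcf hm) _ hcover
  rw [orderAlong_mul, hc₀, zero_add, le_orderAlong_iff] at hle
  have hsub : variablesIn p ⊆ C := fun x hx =>
    X_mem_variableIdeal_iff.1 (hpC (mem_variablesIn.1 hx))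
  exact le_orderAlong_iff.2 fun m hm => (hle m hm).trans (Finset.sum_le_sum_of_subset hsub)

/-- At a minimal prime `p`, every variable `X x ∈ p` is turned into an edge by an `X (n x) ∉ p`, so
multiplication by the unit `∏ X (n x) ^ m x` of the localization brings the monomial into the
`t`-th power. -/
lemma monomial_mem_symbolicPower {m : V →₀ ℕ} (hm : m ∈ symbolicMonomials G t) (r : K) :
    monomial m r ∈ (edgeIdeal K G).symbolicPower t := by
  classical
  refine mem_symbolicPower_iff.2 fun p hp => ?_
  have hprime : p.IsPrime := Ideal.IsMinimalPrime.isPrime hp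
  choose! n hadj hn using fun x (hx : x ∈ variablesIn p) => exists_adj_notMem_variablesIn hp hx
  refine ⟨∏ x ∈ variablesIn p, X (n x) ^ m x, fun hmem => ?_, ?_⟩
  · obtain ⟨x, hx, hmem⟩ := hprime.prod_mem_iff.1 hmem
    exact hn x hx (mem_variablesIn.2 (hprime.mem_of_pow_mem _ hmem))
  have hdvd : (∏ x ∈ variablesIn p, X x ^ m x : MvPolynomial V K) ∣ monomial m r := by
    have := Fintype.ofFinite V
    rw [monomial_eq, Finsupp.prod_fintype _ _ fun _ => pow_zero _]
    exact (Finset.prod_dvd_prod_of_subset _ _ _ (Finset.subset_univ _)).mul_left _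
  refine Ideal.mem_of_dvd _ (mul_dvd_mul_left _ hdvd) ?_
  rw [← Finset.prod_mul_distrib]
  refine Ideal.pow_le_pow_right (hm _ (isVertexCover_variablesIn hp.1.2)) ?_
  rw [← Finset.prod_pow_eq_pow_sum]
  refine Ideal.prod_mem_prod fun x hx => ?_
  rw [← mul_pow]
  have hedge : (X (n x) * X x : MvPolynomial V K) ∈ edgeIdeal K G :=
    Ideal.subset_span ⟨n x, x, (hadj x hx).symm, rfl⟩
  exact Ideal.pow_mem_pow hedge _

theorem symbolicPower_edgeIdeal_eq_restrictSupportIdeal (t : ℕ) :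
    (edgeIdeal K G).symbolicPower t =
      restrictSupportIdeal K (symbolicMonomials G t) (isUpperSet_symbolicMonomials t) := by
  refine le_antisymm (fun f hf m hm C hC =>
    le_orderAlong_iff.1 (le_orderAlong_of_mem_symbolicPower hC hf) m hm) fun f hf => ?_
  rw [← support_sum_monomial_coeff f]
  exact Ideal.sum_mem _ fun m hm => monomial_mem_symbolicPower (hf hm) _

end EdgeIdealSymbolicPowers

theorem symbolicPower_succ_le_pow {K V : Type*} [Field K] [Finite V] {G : SimpleGraph V} {s : ℕ}
    (hG : ∀ v (c : G.Walk v v), c.IsCycle → Odd c.length → 2 * s ≤ c.length + 1) :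
    (edgeIdeal K G).symbolicPower (s + 1) ≤ edgeIdeal K G ^ s := by
  rw [symbolicPower_edgeIdeal_eq_restrictSupportIdeal, edgeIdeal_pow_eq_restrictSupportIdeal]
  exact restrictSupportIdeal_mono (symbolicMonomials_subset_powerMonomials hG)

theorem theorem3p8_general {K : Type*} [Field K] {V : Type*} [Finite V] (G : SimpleGraph V)
    (s : ℕ) :
    regularity ((edgeIdeal K G).symbolicPower (s + 1)) ≤
      max (regularity (edgeIdeal K G) + ((2 * s : ℕ) : WithBot (WithTop ℤ)))
        (regularity ((edgeIdeal K G).symbolicPower (s + 1) ⊔ edgeIdeal K G ^ s)) := by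
  have := Fintype.ofFinite V
  let _ : LinearOrder V := LinearOrder.lift' (Fintype.equivFin V) (Fintype.equivFin V).injective
  rw [symbolicPower_edgeIdeal_eq_restrictSupportIdeal, edgeIdeal_pow_eq_restrictSupportIdeal,
    edgeIdeal_eq_restrictSupportIdeal, restrictSupportIdeal_sup]
  refine le_of_forall_intCast_le fun r hr => ?_
  obtain ⟨hedge, hunion⟩ := max_le_iff.1 hr
  rw [regularity_restrictSupportIdeal_le_iff] at hunion ⊢
  have hedge' := regularity_restrictSupportIdeal_le_iff.1 (le_coe_sub_of_add_le hedge)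
  rw [← sub_add_cancel r ((2 * s : ℕ) : ℤ)] at hunion ⊢
  exact hedge'.symbolicMonomials_of_union hunion

end

theorem theorem3p8 {K : Type*} [Field K] {V : Type*} [Finite V] (G : SimpleGraph V)
    (s : ℕ) (hs : 1 ≤ s)
    (hG : ∀ (v : V) (c : G.Walk v v), c.IsCycle → Odd c.length →
      ¬ ((c.length : ℤ) ≤ 2 * (s : ℤ) - 3)) :
    regularity ((edgeIdeal K G).symbolicPower (s + 1)) ≤
      max (regularity (edgeIdeal K G) + ((2 * s : ℕ) : WithBot (WithTop ℤ)))
        (regularity ((edgeIdeal K G) ^ s)) := by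
  have hodd : ∀ v (c : G.Walk v v), c.IsCycle → Odd c.length → 2 * s ≤ c.length + 1 := by
    intro v c hc hlen
    have := hG v c hc hlen
    obtain ⟨k, hk⟩ := hlen
    omega
  have h := theorem3p8_general (K := K) G s
  rwa [sup_eq_right.2 (symbolicPower_succ_le_pow hodd)] at h
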